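/- Let $\mathbb K$ be an algebraically closed field of characteristic $0$, let $\mathfrak g$ be a finite-dimensional reductive Lie algebra over $\mathbb K$, let $\vartheta$ be a Lie algebra automorphism of $\mathfrak g$ of finite order $m\ge 1$, and let $\zeta\in\mathbb K$ be a primitive $m$-th root of unity. Let $\Theta$ be the automorphism of the loop algebra $\mathfrak g[t,t^{-1}]=\mathfrak g\otimes\mathbb K[t,t^{-1}]$ given by $\Theta(\xi t^k)=\zeta^k\vartheta(\xi)t^k$ for $\xi\in\mathfrak g$, $k\in\mathbb Z$, and put $$\widehat{\mathfrak g}_+^{\vartheta}=\mathfrak g[t]^{\Theta},\qquad \mathfrak g[t^{-1}]^{\vartheta}=\mathfrak g[t^{-1}]^{\Theta},$$ the Lie subalgebras of $\Theta$-fixed points in $\mathfrak g[t]$ and in $\mathfrak g[t^{-1}]$. Identify the vector space $\widehat{\mathfrak g}_+^{\vartheta}$ with $(\mathfrak g[t,t^{-1}]/t^{-1}\mathfrak g[t^{-1}])^{\Theta}$. In this way $\mathfrak g[t^{-1}]^{\vartheta}$ acts on $\widehat{\mathfrak g}_+^{\vartheta}$ (the element $y\cdot x$ is the representative in $\mathfrak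 g[t]$ of $[y,x]$ modulo $t^{-1}\mathfrak g[t^{-1}]$) and hence, by derivations, on the symmetric algebra $\mathcal S(\widehat{\mathfrak g}_+^{\vartheta})$. Let $$\mathcal Z(\widehat{\mathfrak g}^{\vartheta},[0])=\mathcal S(\widehat{\mathfrak g}_+^{\vartheta})^{\mathfrak g[t^{-1}]^{\vartheta}}$$ be the subalgebra of elements annihilated by $\mathfrak g[t^{-1}]^{\vartheta}$. Then $\mathcal Z(\widehat{\mathfrak g}^{\vartheta},[0])$ is Poisson-commutative, that is, $\{F,G\}=0$ for all $F,G\in\mathcal Z(\widehat{\mathfrak g}^{\vartheta},[0])$, where $\{\,,\}$ is the Poisson bracket on $\mathcal S(\widehat{\mathfrak g}_+^{\vartheta})$ that extends the Lie bracket of $\widehat{\mathfrak g}_+^{\vartheta}$. -/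

import Mathlib

open scoped TensorProduct

noncomputable section

namespace TwistedLoop

/-! ### Derivations of a symmetric algebra and the Lie-Poisson bracket -/

section Poisson

variable {K : Type*} [CommRing K] {V : Type*} [AddCommGroup V] [Module K V]

/-- The algebra map `S(V) → S(V) ⊕ ε S(V)`, `ε² = 0`, with `v ↦ v + ε f(v)` for `v ∈ V`. -/
def sqZeroMap (f : V →ₗ[K] SymmetricAlgebra K V) :
    SymmetricAlgebra K V →ₐ[K] TrivSqZeroExt (SymmetricAlgebra K V) (SymmetricAlgebra K V) :=
  SymmetricAlgebra.lift
    { toFun := fun v => TrivSqZeroExt.inl (SymmetricAlgebra.ι K V v) + TrivSqZeroExt.inr (f v)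
      map_add' := fun v w => by ext <;> simp
      map_smul' := fun c v => by ext <;> simp }

theorem sqZeroMap_ι (f : V →ₗ[K] SymmetricAlgebra K V) (v : V) :
    sqZeroMap f (SymmetricAlgebra.ι K V v) =
      TrivSqZeroExt.inl (SymmetricAlgebra.ι K V v) + TrivSqZeroExt.inr (f v) :=
  SymmetricAlgebra.lift_ι_apply _ _

theorem fst_sqZeroMap (f : V →ₗ[K] SymmetricAlgebra K V) (a : SymmetricAlgebra K V) :
    (sqZeroMap f a).fst = a := by
  have h : (TrivSqZeroExt.fstHom K (SymmetricAlgebra K V) (SymmetricAlgebra K V)).comp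
      (sqZeroMap f) = AlgHom.id K _ := by
    apply SymmetricAlgebra.algHom_ext
    ext v
    simp [sqZeroMap_ι]
  exact DFunLike.congr_fun h a

/-- The unique `K`-derivation of `S(V)` extending a linear map `f : V → S(V)`. -/
def derivLift (f : V →ₗ[K] SymmetricAlgebra K V) :
    Derivation K (SymmetricAlgebra K V) (SymmetricAlgebra K V) :=
  Derivation.mk'
    { toFun := fun a => (sqZeroMap f a).snd
      map_add' := fun a b => by simp
      map_smul' := fun c a => by simp }
    (fun a b => by simp [fst_sqZeroMap, mul_comm])

theorem derivLift_ι (f : V →ₗ[K] SymmetricAlgebra K V) (v : V) :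
    derivLift f (SymmetricAlgebra.ι K V v) = f v := by
  change (sqZeroMap f (SymmetricAlgebra.ι K V v)).snd = f v
  simp [sqZeroMap_ι]

theorem derivation_ext {D₁ D₂ : Derivation K (SymmetricAlgebra K V) (SymmetricAlgebra K V)}
    (h : ∀ v, D₁ (SymmetricAlgebra.ι K V v) = D₂ (SymmetricAlgebra.ι K V v)) : D₁ = D₂ := by
  ext a
  induction a using SymmetricAlgebra.induction with
  | algebraMap r => simp
  | ι x => exact h x
  | mul a b ha hb => simp [ha, hb]
  | add a b ha hb => simp [ha, hb]

variable {L : Type*} [LieRing L] [LieAlgebra K L]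

/-- The derivation `{x, ·}` of `S(L)` extending `ad x`, for `x ∈ L`. -/
def adDeriv : L →ₗ[K] Derivation K (SymmetricAlgebra K L) (SymmetricAlgebra K L) where
  toFun x := derivLift (SymmetricAlgebra.ι K L ∘ₗ (LieAlgebra.ad K L x : L →ₗ[K] L))
  map_add' x y := derivation_ext fun v => by simp [derivLift_ι]
  map_smul' c x := derivation_ext fun v => by simp [derivLift_ι]

/-- The Poisson bracket `{F, G}` on `S(L)`: the biderivation with `{x, y} = [x, y]` for
`x, y ∈ L`. For fixed `G` it is the derivation in `F` extending `x ↦ {x, G}`. -/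
def poisson (F G : SymmetricAlgebra K L) : SymmetricAlgebra K L :=
  derivLift
    { toFun := fun x : L => adDeriv x G
      map_add' := fun x y => by simp
      map_smul' := fun c x => by simp } F

theorem poisson_ι_left (x : L) (G : SymmetricAlgebra K L) :
    poisson (SymmetricAlgebra.ι K L x) G = adDeriv x G := by
  simp [poisson, derivLift_ι]

theorem poisson_ι_ι (x y : L) :
    poisson (SymmetricAlgebra.ι K L x) (SymmetricAlgebra.ι K L y) =
      SymmetricAlgebra.ι K L ⁅x, y⁆ := by
  rw [poisson_ι_left]
  simp [adDeriv, derivLift_ι]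

theorem poisson_add_left (F F' G : SymmetricAlgebra K L) :
    poisson (F + F') G = poisson F G + poisson F' G := by
  simp [poisson]

theorem poisson_mul_left (F F' G : SymmetricAlgebra K L) :
    poisson (F * F') G = F * poisson F' G + F' * poisson F G := by
  simp [poisson]

theorem poisson_algebraMap_left (r : K) (G : SymmetricAlgebra K L) :
    poisson (algebraMap K _ r) G = 0 := by
  simp [poisson]

theorem poisson_add_right (F G G' : SymmetricAlgebra K L) :
    poisson F (G + G') = poisson F G + poisson F G' := by
  induction F using SymmetricAlgebra.induction with
  | algebraMap r => simp [poisson_algebraMap_left]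
  | ι x => simp [poisson_ι_left]
  | mul a b ha hb => simp only [poisson_mul_left, ha, hb]; ring
  | add a b ha hb => simp only [poisson_add_left, ha, hb]; ring

theorem poisson_mul_right (F G G' : SymmetricAlgebra K L) :
    poisson F (G * G') = G * poisson F G' + G' * poisson F G := by
  induction F using SymmetricAlgebra.induction with
  | algebraMap r => simp [poisson_algebraMap_left]
  | ι x => simp [poisson_ι_left]
  | mul a b ha hb => simp only [poisson_mul_left, ha, hb]; ring
  | add a b ha hb => simp only [poisson_add_left, ha, hb]; ring

theorem poisson_algebraMap_right (F : SymmetricAlgebra K L) (r : K) :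
    poisson F (algebraMap K _ r) = 0 := by
  induction F using SymmetricAlgebra.induction with
  | algebraMap r => simp [poisson_algebraMap_left]
  | ι x => simp [poisson_ι_left]
  | mul a b ha hb => simp [poisson_mul_left, ha, hb]
  | add a b ha hb => simp [poisson_add_left, ha, hb]

theorem poisson_skew (F G : SymmetricAlgebra K L) : -poisson G F = poisson F G := by
  induction F using SymmetricAlgebra.induction with
  | algebraMap r => simp [poisson_algebraMap_left, poisson_algebraMap_right]
  | ι x =>
    induction G using SymmetricAlgebra.induction with
    | algebraMap r => simp [poisson_algebraMap_left, poisson_algebraMap_right]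
    | ι y => rw [poisson_ι_ι, poisson_ι_ι, ← map_neg, lie_skew]
    | mul a b ha hb => rw [poisson_mul_left, poisson_mul_right, ← ha, ← hb]; ring
    | add a b ha hb => rw [poisson_add_left, poisson_add_right, ← ha, ← hb]; ring
  | mul a b ha hb => rw [poisson_mul_left, poisson_mul_right, ← ha, ← hb]; ring
  | add a b ha hb => rw [poisson_add_left, poisson_add_right, ← ha, ← hb]; ring

/-- A subalgebra `A ⊆ S(L)` is Poisson-commutative if `{A, A} = 0`. -/
def IsPoissonCommutative (A : Subalgebra K (SymmetricAlgebra K L)) : Prop :=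
  ∀ F ∈ A, ∀ G ∈ A, poisson F G = 0

end Poisson

/-! ### The twisted loop algebra -/

section Loop

open LieAlgebra LieAlgebra.LoopAlgebra

variable (K : Type*) [Field K] (g : Type*) [LieRing g] [LieAlgebra K g]

/-- The loop algebra `g[t, t⁻¹] = K[t, t⁻¹] ⊗ g`, as a Lie algebra over `K`. -/
def Loop : Type _ := loopAlgebra K ℤ g

instance : LieRing (Loop K g) := inferInstanceAs (LieRing (loopAlgebra K ℤ g))

instance : LieAlgebra K (Loop K g) := inferInstanceAs (LieAlgebra K (loopAlgebra K ℤ g))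

variable {K g}

/-- An element of `g[t, t⁻¹]` as the finitely supported family of its coefficients. -/
def coeffEquiv : Loop K g ≃ₗ[K] (ℤ →₀ g) := toFinsupp K ℤ g

/-- The coefficient of `t ^ k` of an element of `g[t, t⁻¹]`. -/
def coeff (k : ℤ) : Loop K g →ₗ[K] g :=
  Finsupp.lapply k ∘ₗ (coeffEquiv (K := K) (g := g)).toLinearMap

/-- The monomial `ξ t ^ k`. -/
def mono (k : ℤ) (ξ : g) : Loop K g :=
  (AddMonoidAlgebra.single k (1 : K) ⊗ₜ[K] ξ : loopAlgebra K ℤ g)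

theorem coeffEquiv_mono (k : ℤ) (ξ : g) :
    coeffEquiv (mono (K := K) k ξ) = Finsupp.single k ξ :=
  toFinsupp_single_tmul K ℤ g k ξ

theorem coeff_mono (k l : ℤ) (ξ : g) : coeff l (mono (K := K) k ξ) = if k = l then ξ else 0 := by
  change coeffEquiv (mono (K := K) k ξ) l = _
  rw [coeffEquiv_mono, Finsupp.single_apply]

theorem ext_coeff {x y : Loop K g} (h : ∀ k, coeff k x = coeff k y) : x = y :=
  (coeffEquiv (K := K)).injective (Finsupp.ext h)

theorem lie_mono (k l : ℤ) (ξ η : g) :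
    ⁅mono (K := K) k ξ, mono (K := K) l η⁆ = mono (K := K) (k + l) ⁅ξ, η⁆ := by
  change (AddMonoidAlgebra.single k (1 : K) * AddMonoidAlgebra.single l (1 : K)) ⊗ₜ[K] ⁅ξ, η⁆ = _
  rw [AddMonoidAlgebra.single_mul_single, mul_one]
  rfl

theorem eq_sum_mono (x : Loop K g) :
    x = ∑ k ∈ (coeffEquiv x).support, mono k (coeff k x) := by
  apply ext_coeff
  intro l
  rw [map_sum]
  simp only [coeff_mono, Finset.sum_ite_eq']
  split_ifs with h
  · rfl
  · exact Finsupp.notMem_support_iff.1 h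

variable (K g) in
/-- The elements of `g[t, t⁻¹]` involving only the powers `t ^ k` with `k ∈ S`. -/
def supported (S : Set ℤ) : Submodule K (Loop K g) where
  carrier := {x | ∀ k, k ∉ S → coeff k x = 0}
  add_mem' hx hy k hk := by rw [map_add, hx k hk, hy k hk, add_zero]
  zero_mem' k _ := map_zero _
  smul_mem' c x hx k hk := by rw [map_smul, hx k hk, smul_zero]

theorem lie_mem_supported {S T U : Set ℤ} (h : ∀ i ∈ S, ∀ j ∈ T, i + j ∈ U)
    {x y : Loop K g} (hx : x ∈ supported K g S) (hy : y ∈ supported K g T) :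
    ⁅x, y⁆ ∈ supported K g U := by
  rw [eq_sum_mono x, eq_sum_mono y, sum_lie]
  refine Submodule.sum_mem _ fun i _ => ?_
  rw [lie_sum]
  refine Submodule.sum_mem _ fun j _ => ?_
  rw [lie_mono]
  intro k hk
  rw [coeff_mono]
  split_ifs with hij
  · by_cases hi : i ∈ S
    · by_cases hj : j ∈ T
      · exact absurd (hij ▸ h i hi j hj) hk
      · rw [hy j hj, lie_zero]
    · rw [hx i hi, zero_lie]
  · rfl

variable (K g) in
/-- The Lie subalgebra `g[t] ⊆ g[t, t⁻¹]`. -/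
def nonnegPart : LieSubalgebra K (Loop K g) where
  __ := supported K g (Set.Ici 0)
  lie_mem' hx hy := lie_mem_supported
    (fun _ hi _ hj => add_nonneg (Set.mem_Ici.1 hi) (Set.mem_Ici.1 hj)) hx hy

variable (K g) in
/-- The Lie subalgebra `g[t⁻¹] ⊆ g[t, t⁻¹]`. -/
def nonposPart : LieSubalgebra K (Loop K g) where
  __ := supported K g (Set.Iic 0)
  lie_mem' hx hy := lie_mem_supported
    (fun _ hi _ hj => add_nonpos (Set.mem_Iic.1 hi) (Set.mem_Iic.1 hj)) hx hy

/-- The automorphism `t ↦ ζ t` of the algebra of Laurent polynomials. -/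
def rescale (ζ : Kˣ) : AddMonoidAlgebra K ℤ →ₐ[K] AddMonoidAlgebra K ℤ :=
  AddMonoidAlgebra.lift K (AddMonoidAlgebra K ℤ) ℤ
    { toFun := fun k => AddMonoidAlgebra.single k.toAdd ((ζ ^ k.toAdd : Kˣ) : K)
      map_one' := by rw [toAdd_one, zpow_zero, Units.val_one, AddMonoidAlgebra.one_def]
      map_mul' := fun k l => by
        rw [AddMonoidAlgebra.single_mul_single, toAdd_mul, zpow_add, Units.val_mul] }

/-- The map `Θ` of `g[t, t⁻¹]` with `Θ (ξ t ^ k) = ζ ^ k θ(ξ) t ^ k`. -/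
def twist (θ : g ≃ₗ⁅K⁆ g) (ζ : Kˣ) : Loop K g →ₗ⁅K⁆ Loop K g :=
  LieAlgebra.ExtendScalars.map (rescale ζ) θ.toLieHom

theorem twist_mono (θ : g ≃ₗ⁅K⁆ g) (ζ : Kˣ) (k : ℤ) (ξ : g) :
    twist θ ζ (mono k ξ) = mono k (((ζ ^ k : Kˣ) : K) • θ ξ) := by
  have h : rescale ζ (AddMonoidAlgebra.single k (1 : K)) =
      ((ζ ^ k : Kˣ) : K) • AddMonoidAlgebra.single k (1 : K) := by
    rw [rescale, AddMonoidAlgebra.lift_single, one_smul, AddMonoidAlgebra.smul_single,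
      smul_eq_mul, mul_one]
    rfl
  change rescale ζ (AddMonoidAlgebra.single k (1 : K)) ⊗ₜ[K] θ ξ = _
  rw [h, TensorProduct.smul_tmul]
  rfl

theorem coeff_twist (θ : g ≃ₗ⁅K⁆ g) (ζ : Kˣ) (k : ℤ) (x : Loop K g) :
    coeff k (twist θ ζ x) = ((ζ ^ k : Kˣ) : K) • θ (coeff k x) := by
  have h : ∀ l, coeff k (twist θ ζ (mono l (coeff l x))) =
      ((ζ ^ k : Kˣ) : K) • θ (coeff k (mono (K := K) l (coeff l x))) := by
    intro l
    rw [twist_mono, coeff_mono, coeff_mono]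
    split_ifs with hl
    · rw [hl]
    · simp
  conv_lhs => rw [eq_sum_mono x]
  conv_rhs => rw [eq_sum_mono x]
  simp only [map_sum, Finset.smul_sum, h]

/-- The twisted loop algebra: the fixed points of `Θ` in `g[t, t⁻¹]`. -/
def twistedLoop (θ : g ≃ₗ⁅K⁆ g) (ζ : Kˣ) : LieSubalgebra K (Loop K g) where
  carrier := {x | twist θ ζ x = x}
  add_mem' hx hy := by
    simp only [Set.mem_ofPred_eq] at hx hy ⊢
    rw [map_add, hx, hy]
  zero_mem' := map_zero (twist θ ζ)
  smul_mem' c x hx := by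
    simp only [Set.mem_ofPred_eq] at hx ⊢
    rw [map_smul, hx]
  lie_mem' hx hy := by
    simp only [Set.mem_ofPred_eq] at hx hy ⊢
    rw [LieHom.map_lie, hx, hy]

/-- `Θ`-invariance means that the coefficient of `t ^ k` is a `ζ ^ (-k)`-eigenvector of `θ`. -/
theorem mem_twistedLoop_iff (θ : g ≃ₗ⁅K⁆ g) (ζ : Kˣ) (x : Loop K g) :
    x ∈ twistedLoop θ ζ ↔ ∀ k, θ (coeff k x) = ((ζ ^ (-k) : Kˣ) : K) • coeff k x := by
  have h : ∀ k, coeff k (twist θ ζ x) = coeff k x ↔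
      θ (coeff k x) = ((ζ ^ (-k) : Kˣ) : K) • coeff k x := by
    intro k
    rw [coeff_twist]
    constructor
    · intro h
      conv_rhs => rw [← h, smul_smul, ← Units.val_mul, ← zpow_add]
      simp
    · intro h
      rw [h, smul_smul, ← Units.val_mul, ← zpow_add]
      simp
  simp only [← h]
  exact ⟨fun hx k => congrArg (coeff k) hx, ext_coeff⟩

/-- `g[t]^Θ`, the non-negative part of the twisted loop algebra. -/
def twistedNonneg (θ : g ≃ₗ⁅K⁆ g) (ζ : Kˣ) : LieSubalgebra K (Loop K g) :=
  twistedLoop θ ζ ⊓ nonnegPart K g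

/-- `g[t⁻¹]^Θ`, the non-positive part of the twisted loop algebra. -/
def twistedNonpos (θ : g ≃ₗ⁅K⁆ g) (ζ : Kˣ) : LieSubalgebra K (Loop K g) :=
  twistedLoop θ ζ ⊓ nonposPart K g

/-! ### The action of the non-positive part on the non-negative part -/

variable (K g) in
/-- The projection of `g[t, t⁻¹] = g[t] ⊕ t⁻¹ g[t⁻¹]` onto `g[t]`. -/
def projNonneg : Loop K g →ₗ[K] Loop K g where
  toFun x := (coeffEquiv (K := K)).symm ((coeffEquiv x).filter (0 ≤ ·))
  map_add' x y := by rw [map_add, Finsupp.filter_add, map_add]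
  map_smul' c x := by rw [map_smul, Finsupp.filter_smul, map_smul, RingHom.id_apply]

theorem coeff_projNonneg (k : ℤ) (x : Loop K g) :
    coeff k (projNonneg K g x) = if 0 ≤ k then coeff k x else 0 := by
  change coeffEquiv (projNonneg K g x) k = _
  rw [projNonneg]
  change coeffEquiv ((coeffEquiv (K := K)).symm _) k = _
  rw [LinearEquiv.apply_symm_apply, Finsupp.filter_apply]
  rfl

theorem sub_projNonneg_mem (x : Loop K g) :
    x - projNonneg K g x ∈ supported K g (Set.Iio 0) := by
  intro k hk
  have hk' : 0 ≤ k := not_lt.1 hk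
  simp [coeff_projNonneg, hk']

theorem projNonneg_eq_zero {x : Loop K g} (hx : x ∈ supported K g (Set.Iio 0)) :
    projNonneg K g x = 0 := by
  apply ext_coeff
  intro k
  rw [coeff_projNonneg, map_zero]
  split_ifs with h
  · exact hx k (not_lt.2 h)
  · rfl

theorem projNonneg_mem {θ : g ≃ₗ⁅K⁆ g} {ζ : Kˣ} {x : Loop K g}
    (hx : x ∈ twistedLoop θ ζ) : projNonneg K g x ∈ twistedNonneg θ ζ := by
  refine ⟨ext_coeff fun k => ?_, fun k hk => ?_⟩
  · have h : coeff k (twist θ ζ x) = coeff k x := congrArg (coeff k) hx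
    rw [coeff_twist] at h ⊢
    rw [coeff_projNonneg]
    split_ifs
    · exact h
    · simp
  · rw [coeff_projNonneg, if_neg (fun h => hk (Set.mem_Ici.2 h))]

/-- Replacing `x` by its image modulo `t⁻¹ g[t⁻¹]` does not change `y · x`. -/
theorem projNonneg_lie_projNonneg {y : Loop K g} (hy : y ∈ nonposPart K g)
    (x : Loop K g) :
    projNonneg K g ⁅y, projNonneg K g x⁆ = projNonneg K g ⁅y, x⁆ := by
  have h : ⁅y, x - projNonneg K g x⁆ ∈ supported K g (Set.Iio 0) :=
    lie_mem_supported (fun i hi j hj => add_neg_of_nonpos_of_neg (Set.mem_Iic.1 hi)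
      (Set.mem_Iio.1 hj)) hy (sub_projNonneg_mem x)
  have h' := projNonneg_eq_zero h
  rw [lie_sub, map_sub, sub_eq_zero] at h'
  exact h'.symm

/-- The action of `g[t⁻¹]^Θ` on `g[t]^Θ`, the latter being identified with
`(g[t, t⁻¹] / t⁻¹ g[t⁻¹])^Θ`: the element `y · x` is the representative in `g[t]^Θ` of the class
of `[y, x]` modulo `t⁻¹ g[t⁻¹]`. -/
def action (θ : g ≃ₗ⁅K⁆ g) (ζ : Kˣ) :
    twistedNonpos θ ζ →ₗ[K] Module.End K (twistedNonneg θ ζ) where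
  toFun y :=
    { toFun := fun x => ⟨projNonneg K g ⁅(y : Loop K g), (x : Loop K g)⁆,
        projNonneg_mem ((twistedLoop θ ζ).lie_mem y.2.1 x.2.1)⟩
      map_add' := fun x x' => Subtype.ext (by simp)
      map_smul' := fun c x => Subtype.ext (by simp) }
  map_add' y y' := LinearMap.ext fun x => Subtype.ext (by simp)
  map_smul' c y := LinearMap.ext fun x => Subtype.ext (by simp)

theorem coe_action (θ : g ≃ₗ⁅K⁆ g) (ζ : Kˣ) (y : twistedNonpos θ ζ) (x : twistedNonneg θ ζ) :
    (action θ ζ y x : Loop K g) = projNonneg K g ⁅(y : Loop K g), (x : Loop K g)⁆ := rfl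

/-- This is an action of the Lie algebra `g[t⁻¹]^Θ`. -/
theorem action_lie (θ : g ≃ₗ⁅K⁆ g) (ζ : Kˣ) (y y' : twistedNonpos θ ζ)
    (x : twistedNonneg θ ζ) :
    action θ ζ ⁅y, y'⁆ x = action θ ζ y (action θ ζ y' x) - action θ ζ y' (action θ ζ y x) := by
  apply Subtype.ext
  rw [AddSubgroupClass.coe_sub, coe_action, coe_action, coe_action, coe_action, coe_action,
    LieSubalgebra.coe_bracket]
  rw [projNonneg_lie_projNonneg y.2.2, projNonneg_lie_projNonneg y'.2.2, lie_lie, map_sub]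

theorem lie_sub_action_mem (θ : g ≃ₗ⁅K⁆ g) (ζ : Kˣ) (y : twistedNonpos θ ζ)
    (x : twistedNonneg θ ζ) :
    ⁅(y : Loop K g), (x : Loop K g)⁆ - (action θ ζ y x : Loop K g) ∈
      supported K g (Set.Iio 0) := by
  rw [coe_action]
  exact sub_projNonneg_mem _

/-- The algebra of invariants of `g[t⁻¹]^Θ` in the symmetric algebra of `g[t]^Θ`, on which
`g[t⁻¹]^Θ` acts by the derivations extending its action on `g[t]^Θ`. -/
def invariants (θ : g ≃ₗ⁅K⁆ g) (ζ : Kˣ) :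
    Subalgebra K (SymmetricAlgebra K (twistedNonneg θ ζ)) where
  carrier := {F | ∀ y : twistedNonpos θ ζ,
    derivLift (SymmetricAlgebra.ι K (twistedNonneg θ ζ) ∘ₗ action θ ζ y) F = 0}
  add_mem' hF hG y := by rw [map_add, hF y, hG y, add_zero]
  mul_mem' hF hG y := by rw [Derivation.leibniz, hF y, hG y, smul_zero, smul_zero, add_zero]
  algebraMap_mem' r y := Derivation.map_algebraMap _ r

end Loop

end TwistedLoop

end

/-! At a functional `A` on `g[t]^Θ` the bracket `{F, G}` takes the value `A ⁅v, w⁆`, where `v` and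
`w` are the differentials of `F` and `G` at `A`. It suffices that this vanishes for generic `A`;
here generic means all but finitely many points of a suitable line through each functional
(`eq_zero_of_evalAt_line`).

Let `L` be the semisimple quotient of `g` by its center and `κ` its Killing form. In degree `k`, `A`
evaluated on brackets has the form `κ(a k, ·)` (`exists_killingForm_eq`), so `A` is encoded by a
power series `a = ∑ a k X ^ k` over `L`. If `v` has degree at most `N`, let `b` be the image in `L`
of the reversed polynomial `X ^ N v(X⁻¹)`. Invariance of `F` says that `[a, b]` vanishes through
order `N` (`sum_lie_coeff_eq_zero`); the same holds for the reversal `b'` of `w`. Moreover `A ⁅v,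
w⁆` is the coefficient of `X ^ (2 N)` in `κ([a, b], b')`.

Suppose `a 0` is regular semisimple. A formal differential equation moves the centralizer of `a 0`
to series that commute with `a` to all orders, so `b` agrees through order `N` with some `c`
commuting with `a` (`IsRegularSemisimple.exists_commute_of_forall_le`). Then `[a, b] = [a, b - c]`,
with `b - c` and `[a, b']` both of order at least `N + 1`, and cyclicity of the trace kills the
coefficient (`trace_coeff_commutator_mul_eq_zero`).

It remains to see that `a 0`, which is fixed by the induced automorphism, is generically regular
semisimple. For a generic fixed element `x`, the fixed points in its Engel subalgebra act
nilpotently on that subalgebra, which is therefore solvable by Kreknin's theorem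
(`isSolvable_of_fixed_nilpotent`). Lie's theorem and nondegeneracy of `κ` make it abelian, hence
equal to the centralizer of `x` (`isRegularSemisimple_of_isNilRegular`). -/

namespace TwistedLoop

/-! ### Kreknin's theorem -/

section Kreknin

variable {K : Type*} [CommRing K] {L : Type*} [LieRing L] [LieAlgebra K L] {m : ℕ}

/-- The family of spans of brackets `⁅W i, W j⁆`, `i + j = k`. -/
def derivedFamily (W : ZMod m → Submodule K L) (k : ZMod m) : Submodule K L :=
  Submodule.span K {z | ∃ i j, i + j = k ∧ ∃ x ∈ W i, ∃ y ∈ W j, ⁅x, y⁆ = z}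

theorem lie_mem_derivedFamily {W : ZMod m → Submodule K L} {i j : ZMod m} {x y : L}
    (hx : x ∈ W i) (hy : y ∈ W j) : ⁅x, y⁆ ∈ derivedFamily W (i + j) :=
  Submodule.subset_span ⟨i, j, rfl, x, hx, y, hy, rfl⟩

/-- The graded pieces are compatible with the bracket and the piece of degree `0` vanishes. -/
structure IsGradedWithoutZero (W : ZMod m → Submodule K L) : Prop where
  lie_mem : ∀ i j, ∀ x ∈ W i, ∀ y ∈ W j, ⁅x, y⁆ ∈ W (i + j)
  zero : ∀ x ∈ W 0, x = 0

theorem IsGradedWithoutZero.derivedFamily_le {W : ZMod m → Submodule K L}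
    (hW : IsGradedWithoutZero W) (k : ZMod m) : derivedFamily W k ≤ W k := by
  refine Submodule.span_le.2 ?_
  rintro _ ⟨i, j, rfl, x, hx, y, hy, rfl⟩
  exact hW.lie_mem i j x hx y hy

theorem IsGradedWithoutZero.derivedFamily {W : ZMod m → Submodule K L}
    (hW : IsGradedWithoutZero W) : IsGradedWithoutZero (derivedFamily W) where
  lie_mem i j _ hx _ hy :=
    lie_mem_derivedFamily (hW.derivedFamily_le i hx) (hW.derivedFamily_le j hy)
  zero x hx := hW.zero x (hW.derivedFamily_le 0 hx)

theorem IsGradedWithoutZero.iterate {W : ZMod m → Submodule K L}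
    (hW : IsGradedWithoutZero W) (n : ℕ) :
    IsGradedWithoutZero (TwistedLoop.derivedFamily^[n] W) := by
  induction n with
  | zero => exact hW
  | succ n ih => rw [Function.iterate_succ_apply']; exact ih.derivedFamily

theorem IsGradedWithoutZero.iterate_le {W : ZMod m → Submodule K L}
    (hW : IsGradedWithoutZero W) (n : ℕ) (k : ZMod m) :
    TwistedLoop.derivedFamily^[n] W k ≤ W k := by
  induction n with
  | zero => exact le_rfl
  | succ n ih =>
    rw [Function.iterate_succ_apply']
    exact ((hW.iterate n).derivedFamily_le k).trans ih

/-- Homogeneous elements generated by the graded pieces of residues larger than `n`. -/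
inductive GradedSpan (W : ZMod m → Submodule K L) (n : ℕ) : ZMod m → L → Prop
  | of {j : ZMod m} {x : L} : n < j.val → x ∈ W j → GradedSpan W n j x
  | lie {i j : ZMod m} {x y : L} : GradedSpan W n i x → GradedSpan W n j y →
      GradedSpan W n (i + j) ⁅x, y⁆
  | zero (i : ZMod m) : GradedSpan W n i 0
  | add {i : ZMod m} {x y : L} : GradedSpan W n i x → GradedSpan W n i y →
      GradedSpan W n i (x + y)
  | smul {i : ZMod m} {x : L} (c : K) : GradedSpan W n i x → GradedSpan W n i (c • x)

theorem GradedSpan.mem {W : ZMod m → Submodule K L} (hW : IsGradedWithoutZero W) {n : ℕ}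
    {j : ZMod m} {x : L} (h : GradedSpan W n j x) : x ∈ W j := by
  induction h with
  | of _ hx => exact hx
  | lie _ _ hx hy => exact hW.lie_mem _ _ _ hx _ hy
  | zero i => exact zero_mem _
  | add _ _ hx hy => exact add_mem hx hy
  | smul c _ hx => exact Submodule.smul_mem _ c hx

theorem GradedSpan.trans {W W' : ZMod m → Submodule K L} {n n' : ℕ}
    (H : ∀ j : ZMod m, n' < j.val → ∀ x ∈ W' j, GradedSpan W n j x) {j : ZMod m} {x : L}
    (h : GradedSpan W' n' j x) : GradedSpan W n j x := by
  induction h with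
  | of hj hx => exact H _ hj _ hx
  | lie _ _ hx hy => exact hx.lie hy
  | zero i => exact .zero i
  | add _ _ hx hy => exact hx.add hy
  | smul c _ hx => exact hx.smul c

theorem GradedSpan.of_mem_span {W : ZMod m → Submodule K L} {n : ℕ} {k : ZMod m} {s : Set L}
    (H : ∀ x ∈ s, GradedSpan W n k x) {x : L} (hx : x ∈ Submodule.span K s) :
    GradedSpan W n k x := by
  induction hx using Submodule.span_induction with
  | mem x hx => exact H x hx
  | zero => exact .zero k
  | add x y _ _ hx hy => exact hx.add hy
  | smul c x _ hx => exact hx.smul c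

/-- The Jacobi identity unfolds nested brackets in `v` until the outermost right entry is a single
generator, of residue larger than `n`; everything else is absorbed in the left entry. -/
theorem GradedSpan.lie_mem_span {W : ZMod m → Submodule K L} (hW : IsGradedWithoutZero W)
    {n : ℕ} {j : ZMod m} {v : L} (h : GradedSpan W n j v) :
    ∀ (i : ZMod m), ∀ w ∈ W i, ⁅w, v⁆ ∈ Submodule.span K
      {z | ∃ d : ZMod m, n < d.val ∧ ∃ u ∈ W (i + j - d), ∃ x ∈ W d, ⁅u, x⁆ = z} := by
  induction h with
  | @of j x hj hx =>
    intro i w hw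
    exact Submodule.subset_span ⟨j, hj, w, by simpa using hw, x, hx, rfl⟩
  | @lie a b x y hx hy ihx ihy =>
    intro i w hw
    have h₁ := ihy (i + a) ⁅w, x⁆ (hW.lie_mem _ _ _ hw _ (hx.mem hW))
    have h₂ := ihx (i + b) ⁅w, y⁆ (hW.lie_mem _ _ _ hw _ (hy.mem hW))
    rw [show ⁅w, ⁅x, y⁆⁆ = ⁅⁅w, x⁆, y⁆ - ⁅⁅w, y⁆, x⁆ by
      rw [leibniz_lie w x y, ← lie_skew x ⁅w, y⁆]; abel]
    rw [show i + a + b = i + (a + b) by ring] at h₁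
    rw [show i + b + a = i + (a + b) by ring] at h₂
    exact sub_mem h₁ h₂
  | zero i => intro i w _; simp
  | add _ _ hx hy => intro i w hw; rw [lie_add]; exact add_mem (hx i w hw) (hy i w hw)
  | smul c _ hx => intro i w hw; rw [lie_smul]; exact Submodule.smul_mem _ c (hx i w hw)

/-- This removes the generators of residue `n + 1`. A bracket in degree `k` of residue `n + 1` is a
sum of terms `⁅u, x⁆` with `x` of degree `d` of residue larger than `n`. Either `d = k`, and `u` has
degree `0` and vanishes, or `d` has residue above `n + 1`, and then so has `k - d` because the
subtraction wraps around modulo `m`. -/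
theorem GradedSpan.lie_of_val_eq [NeZero m] {W : ZMod m → Submodule K L}
    (hW : IsGradedWithoutZero W) {n : ℕ} {i j : ZMod m} (hk : (i + j).val = n + 1) {w v : L}
    (hw : w ∈ W i) (h : GradedSpan W n j v) : GradedSpan W (n + 1) (i + j) ⁅w, v⁆ := by
  refine GradedSpan.of_mem_span ?_ (h.lie_mem_span hW i w hw)
  generalize i + j = k at hk
  rintro _ ⟨d, hd, u, hu, x, hx, rfl⟩
  rcases eq_or_ne d k with rfl | hdk
  · rw [sub_self] at hu
    rw [hW.zero u hu, zero_lie]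
    exact .zero _
  · have hd' : n + 1 < d.val := by
      have : d.val ≠ k.val := fun h => hdk (ZMod.val_injective m h)
      omega
    have hkd : n + 1 < (k - d).val := by
      have h1 : (k - d + d).val = k.val := by rw [sub_add_cancel]
      have h2 := ZMod.val_add (k - d) d
      have h3 := ZMod.val_lt d
      by_contra hlt
      rw [h1] at h2
      rcases lt_or_ge ((k - d).val + d.val) m with h | h
      · rw [Nat.mod_eq_of_lt h] at h2; omega
      · rw [Nat.mod_eq_sub_mod h, Nat.mod_eq_of_lt] at h2 <;> omega
    simpa using (GradedSpan.of hkd hu).lie (GradedSpan.of hd' hx)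

/-- The exponent obeys `s ↦ 2 s + 1`. The outer `s` derivations reduce to generators of residue
larger than `n`. One further derivation writes those of residue `n + 1` as brackets. The inner `s`
derivations put the right entry of each bracket in the span that `GradedSpan.lie_of_val_eq`
requires. -/
theorem IsGradedWithoutZero.gradedSpan_of_mem_iterate [NeZero m] (n : ℕ)
    {W : ZMod m → Submodule K L} (hW : IsGradedWithoutZero W) {i : ZMod m} {x : L}
    (hx : x ∈ TwistedLoop.derivedFamily^[2 ^ n - 1] W i) : GradedSpan W n i x := by
  induction n generalizing W i x with
  | zero =>
    rcases eq_or_ne i 0 with rfl | hi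
    · rw [hW.zero x hx]; exact .zero _
    · exact .of (Nat.pos_of_ne_zero ((ZMod.val_ne_zero i).2 hi)) hx
  | succ n ih =>
    have hn : 2 ^ (n + 1) - 1 = (2 ^ n - 1) + 1 + (2 ^ n - 1) := by
      have := Nat.one_le_two_pow (n := n)
      rw [pow_succ]; omega
    rw [hn, add_comm, Function.iterate_add_apply, Function.iterate_succ_apply'] at hx
    have hM := hW.iterate (2 ^ n - 1)
    refine GradedSpan.trans ?_ (ih hM.derivedFamily hx)
    intro j hj y hy
    rcases eq_or_ne j.val (n + 1) with hjn | hjn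
    · refine GradedSpan.of_mem_span ?_ hy
      rintro _ ⟨a, b, rfl, u, hu, v, hv, rfl⟩
      exact GradedSpan.lie_of_val_eq hW hjn (hW.iterate_le _ _ hu) (ih hW hv)
    · exact .of (by omega) (hW.iterate_le _ _ (hM.derivedFamily_le _ hy))

theorem GradedSpan.eq_zero [NeZero m] {W : ZMod m → Submodule K L} {j : ZMod m} {x : L}
    (h : GradedSpan W (m - 1) j x) : x = 0 := by
  induction h with
  | @of j _ hj _ => have := ZMod.val_lt j; omega
  | lie _ _ hx hy => rw [hx, zero_lie]
  | zero i => rfl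
  | add _ _ hx hy => rw [hx, hy, add_zero]
  | smul c _ hx => rw [hx, smul_zero]

theorem lie_mem_iSup_derivedFamily {W : ZMod m → Submodule K L} {x y : L}
    (hx : x ∈ ⨆ i, W i) (hy : y ∈ ⨆ i, W i) : ⁅x, y⁆ ∈ ⨆ i, derivedFamily W i := by
  induction hx using Submodule.iSup_induction' with
  | mem i x hx =>
    induction hy using Submodule.iSup_induction' with
    | mem j y hy => exact Submodule.mem_iSup_of_mem (i + j) (lie_mem_derivedFamily hx hy)
    | zero => simp
    | add y y' _ _ h h' => rw [lie_add]; exact add_mem h h'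
  | zero => simp
  | add x x' _ _ h h' => rw [add_lie]; exact add_mem h h'

/-- **Kreknin's theorem**: a Lie algebra graded by a finite cyclic group, with trivial component
of degree `0`, is solvable. -/
theorem IsGradedWithoutZero.isSolvable [NeZero m] {W : ZMod m → Submodule K L}
    (hW : IsGradedWithoutZero W) (htop : ⨆ i, W i = ⊤) : LieAlgebra.IsSolvable L := by
  have key : ∀ n, (LieAlgebra.derivedSeries K L n).toSubmodule ≤
      ⨆ i, TwistedLoop.derivedFamily^[n] W i := by
    intro n
    induction n with
    | zero => simp [htop]
    | succ n ih =>
      rw [LieAlgebra.derivedSeries_def, LieAlgebra.derivedSeriesOfIdeal_succ,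
        LieSubmodule.lieIdeal_oper_eq_linear_span', Submodule.span_le]
      rintro _ ⟨x, hx, y, hy, rfl⟩
      rw [Function.iterate_succ_apply']
      exact lie_mem_iSup_derivedFamily (ih hx) (ih hy)
  refine LieAlgebra.IsSolvable.mk (R := K) (k := 2 ^ (m - 1) - 1) ?_
  rw [eq_bot_iff]
  intro x hx
  have h := key _ hx
  have hbot : ⨆ i, TwistedLoop.derivedFamily^[2 ^ (m - 1) - 1] W i = ⊥ :=
    iSup_eq_bot.2 fun i => (Submodule.eq_bot_iff _).2 fun x hx =>
      (hW.gradedSpan_of_mem_iterate (m - 1) hx).eq_zero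
  rw [hbot] at h
  exact h

end Kreknin

/-! ### Centralizers in Lie algebras of formal power series -/

section PowerSeries

open Finset

/-- The Euler operator `X d/dX` on power series with coefficients in a (noncommutative) ring. -/
noncomputable def euler {R : Type*} [Ring R] (φ : PowerSeries R) : PowerSeries R :=
  PowerSeries.mk fun n => n • PowerSeries.coeff n φ

variable {R : Type*} [Ring R]

theorem coeff_euler (n : ℕ) (φ : PowerSeries R) : PowerSeries.coeff n (euler φ) = n • PowerSeries.coeff n φ :=
  PowerSeries.coeff_mk _ _

theorem euler_mul (φ ψ : PowerSeries R) : euler (φ * ψ) = euler φ * ψ + φ * euler ψ := by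
  ext n
  rw [map_add, coeff_euler, PowerSeries.coeff_mul, PowerSeries.coeff_mul, PowerSeries.coeff_mul, ← sum_add_distrib, smul_sum]
  refine sum_congr rfl fun p hp => ?_
  rw [coeff_euler, coeff_euler, smul_mul_assoc, mul_smul_comm, ← add_smul, mem_antidiagonal.1 hp]

theorem euler_sub (φ ψ : PowerSeries R) : euler (φ - ψ) = euler φ - euler ψ := by
  ext n
  simp [coeff_euler, smul_sub]

theorem euler_commutator (φ ψ : PowerSeries R) : euler (φ * ψ - ψ * φ) =
    (euler φ * ψ - ψ * euler φ) + (φ * euler ψ - euler ψ * φ) := by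
  rw [euler_sub, euler_mul, euler_mul]
  abel

/-- A solution of a linear differential equation vanishes if its initial value does. -/
theorem eq_zero_of_euler_eq [IsAddTorsionFree R] {u w : PowerSeries R} (hu : PowerSeries.coeff 0 u = 0)
    (hw : PowerSeries.coeff 0 w = 0) (h : euler w = u * w - w * u) : w = 0 := by
  ext n
  induction n using Nat.strong_induction_on with
  | _ n ih =>
    rw [map_zero]
    rcases Nat.eq_zero_or_pos n with rfl | hn
    · exact hw
    -- As `u` has no constant term, the coefficient of order `n` of either product involves only
    -- coefficients of `w` of order below `n`.
    have h1 : PowerSeries.coeff n (u * w) = 0 := by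
      rw [PowerSeries.coeff_mul]
      refine sum_eq_zero fun p hp => ?_
      rcases Nat.eq_zero_or_pos p.1 with hp0 | hp0
      · rw [hp0, hu, zero_mul]
      · rw [ih p.2 (by have := mem_antidiagonal.1 hp; omega), map_zero, mul_zero]
    have h2 : PowerSeries.coeff n (w * u) = 0 := by
      rw [PowerSeries.coeff_mul]
      refine sum_eq_zero fun p hp => ?_
      rcases Nat.eq_zero_or_pos p.2 with hp0 | hp0
      · rw [hp0, hu, mul_zero]
      · rw [ih p.1 (by have := mem_antidiagonal.1 hp; omega), map_zero, zero_mul]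
    have h3 := congrArg (PowerSeries.coeff n) h
    rw [coeff_euler, map_sub, h1, h2, sub_zero] at h3
    exact (smul_eq_zero_iff_right hn.ne').1 h3

end PowerSeries

section Recursion

/-- Definition of a sequence by strong recursion: the `n`-th term is computed from the sequence
truncated below `n`. -/
theorem exists_seq_of_step {S : Type*} (d : S) (step : ℕ → (ℕ → S) → S) :
    ∃ F : ℕ → S, ∀ n, F n = step n (fun k => if k < n then F k else d) := by
  classical
  refine ⟨Nat.lt_wfRel.wf.fix fun n ih => step n fun k => if h : k < n then ih k h else d,
    fun n => ?_⟩
  rw [WellFounded.fix_eq]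
  congr 1

end Recursion

/-! ### Moving the centralizer of a leading coefficient along a power series -/

section Centralizer

open Finset

variable {K : Type*} [Field K] {L : Type*} [LieRing L] [LieAlgebra K L]

/-- `x` behaves like a regular semisimple element: its centralizer `H` is commutative and is
a complement of `[L, x]`. -/
structure IsRegularSemisimple (K : Type*) [Field K] {L : Type*} [LieRing L] [LieAlgebra K L]
    (x : L) : Prop where
  comm : ∀ y z : L, ⁅x, y⁆ = 0 → ⁅x, z⁆ = 0 → ⁅y, z⁆ = 0
  codisjoint : ∀ z : L, ∃ u y : L, ⁅x, y⁆ = 0 ∧ z = ⁅u, x⁆ + y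

/-- The kernel of `ad x`. -/
abbrev centr (K : Type*) [Field K] {L : Type*} [LieRing L] [LieAlgebra K L]
    (x : L) : Submodule K L := LinearMap.ker (LieAlgebra.ad K L x : L →ₗ[K] L)

/-- The decomposition need not be unique, but it can be chosen linearly. In particular `0` is
decomposed trivially, which gives the recursion below its zero initial values. -/
theorem IsRegularSemisimple.exists_section {x : L} (hx : IsRegularSemisimple K x) :
    ∃ (U : L →ₗ[K] L) (P : L →ₗ[K] centr K x), ∀ z, z = ⁅U z, x⁆ + P z := by
  let T : L × centr K x →ₗ[K] L := LinearMap.coprod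
    (-(LieAlgebra.ad K L x : L →ₗ[K] L)) (centr K x).subtype
  have hT : ∀ p, T p = ⁅p.1, x⁆ + p.2 := fun p => by
    simp [T]
  obtain ⟨S, hS⟩ := T.exists_rightInverse_of_surjective <| LinearMap.range_eq_top.2 fun z => by
    obtain ⟨u, y, hy, rfl⟩ := hx.codisjoint z
    exact ⟨(u, ⟨y, hy⟩), hT _⟩
  refine ⟨LinearMap.fst K _ _ ∘ₗ S, LinearMap.snd K _ _ ∘ₗ S, fun z => ?_⟩
  have := LinearMap.congr_fun hS z
  rw [LinearMap.comp_apply, hT] at this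
  exact this.symm

/-- Solution of the system of differential equations `E a = [u, a] + e`, `E C = [u, C]`,
`e = ∑ X ^ j C (f j)`, where `E = X d/dX`, for a given power series `a`. -/
theorem IsRegularSemisimple.exists_solution [CharZero K] {a : ℕ → L} (ha : IsRegularSemisimple K (a 0)) :
    ∃ (u : ℕ → L) (f : ℕ → centr K (a 0)) (C : ℕ → centr K (a 0) →ₗ[K] L),
      u 0 = 0 ∧ (∀ y, C 0 y = y) ∧
      (∀ n, n • a n = ∑ p ∈ antidiagonal n, ⁅u p.1, a p.2⁆ +
        ∑ p ∈ antidiagonal n, C p.1 (f p.2)) ∧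
      ∀ n y, n • C n y = ∑ p ∈ antidiagonal n, ⁅u p.1, C p.2 y⁆ := by
  obtain ⟨U, P, hUP⟩ := ha.exists_section
  let S : Type _ := L × centr K (a 0) × (centr K (a 0) →ₗ[K] L)
  -- In order `n > 0` the first equation reads `z = ⁅u n, a 0⁆ + f n`, where the defect `z` depends
  -- only on earlier terms. So `U` and `P` produce `u n` and `f n`, and division by `n` produces `C
  -- n`. Truncated terms default to `0`, so the unknown summands drop out of `z`.
  let z : ℕ → (ℕ → S) → L := fun n F => n • a n - ∑ p ∈ antidiagonal n, ⁅(F p.1).1, a p.2⁆ -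
    ∑ p ∈ antidiagonal n, (F p.1).2.2 (F p.2).2.1
  -- `C n` already needs `u n`, which the truncated sequence does not contain; it is supplied by
  -- hand.
  let u' : ℕ → (ℕ → S) → ℕ → L := fun n F i => if i = n then U (z n F) else (F i).1
  let C' : ℕ → (ℕ → S) → centr K (a 0) →ₗ[K] L := fun n F =>
    (n : K)⁻¹ • ∑ p ∈ antidiagonal n, (LieAlgebra.ad K L (u' n F p.1) : L →ₗ[K] L) ∘ₗ (F p.2).2.2
  obtain ⟨F, hF⟩ := exists_seq_of_step (0 : S) fun n F =>
    (U (z n F), P (z n F), if n = 0 then (centr K (a 0)).subtype else C' n F)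
  set T : ℕ → ℕ → S := fun n k => if k < n then F k else 0 with hT
  have hF1 : ∀ n, (F n).1 = U (z n (T n)) := fun n => by rw [hF]
  have hF2 : ∀ n, (F n).2.1 = P (z n (T n)) := fun n => by rw [hF]
  have hz0 : z 0 (T 0) = 0 := by simp [z, hT]
  have hu0 : (F 0).1 = 0 := by rw [hF1, hz0, map_zero]
  have hf0 : (F 0).2.1 = 0 := by rw [hF2, hz0, map_zero]
  have hC0 : (F 0).2.2 = (centr K (a 0)).subtype := by rw [hF]; simp
  have hu' : ∀ n : ℕ, ∀ p ∈ antidiagonal n, u' n (T n) p.1 = (F p.1).1 := by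
    intro n p hp
    have := mem_antidiagonal.1 hp
    simp only [u']
    split_ifs with h
    · rw [h, hF1]
    · simp only [hT, if_pos (show p.1 < n by omega)]
  refine ⟨fun n => (F n).1, fun n => (F n).2.1, fun n => (F n).2.2, hu0,
    fun y => by simp [hC0], fun n => ?_, fun n y => ?_⟩
  · rcases Nat.eq_zero_or_pos n with rfl | hn
    · simp [hu0, hf0]
    have h := hUP (z n (T n))
    rw [← hF1, ← hF2] at h
    have h1 : ∑ p ∈ antidiagonal n, ⁅(F p.1).1, a p.2⁆ =
        ∑ p ∈ antidiagonal n, ⁅(T n p.1).1, a p.2⁆ + ⁅(F n).1, a 0⁆ := by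
      have hmem : (n, 0) ∈ antidiagonal n := by simp
      rw [← sum_erase_add _ _ hmem, ← sum_erase_add (f := fun p => ⁅(T n p.1).1, a p.2⁆) _ hmem]
      have : (T n n) = 0 := by simp [hT]
      rw [this]
      simp only [Prod.fst_zero, zero_lie, add_zero]
      congr 1
      refine sum_congr rfl fun p hp => ?_
      obtain ⟨hp1, hp2⟩ := mem_erase.1 hp
      have := mem_antidiagonal.1 hp2
      have : p.1 < n := by
        rcases lt_or_eq_of_le (show p.1 ≤ n by omega) with h | h
        · exact h
        · exact absurd (Prod.ext h (by simp; omega)) hp1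
      simp only [hT, if_pos this]
    have h2 : ∑ p ∈ antidiagonal n, (F p.1).2.2 (F p.2).2.1 =
        ∑ p ∈ antidiagonal n, (T n p.1).2.2 (T n p.2).2.1 + (F n).2.1 := by
      have hmem : (0, n) ∈ antidiagonal n := by simp
      rw [← sum_erase_add _ _ hmem,
        ← sum_erase_add (f := fun p => (T n p.1).2.2 (T n p.2).2.1) _ hmem]
      have : (T n n) = 0 := by simp [hT]
      rw [this]
      simp only [Prod.snd_zero, Prod.fst_zero, map_zero, add_zero, hC0, Submodule.subtype_apply]
      congr 1
      refine sum_congr rfl fun p hp => ?_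
      obtain ⟨hp1, hp2⟩ := mem_erase.1 hp
      have hp3 := mem_antidiagonal.1 hp2
      have h2 : p.2 < n := by
        rcases lt_or_eq_of_le (show p.2 ≤ n by omega) with h | h
        · exact h
        · exact absurd (Prod.ext (by simp; omega) h) hp1
      rcases lt_or_eq_of_le (show p.1 ≤ n by omega) with h | h
      · simp only [hT, if_pos h, if_pos h2]
      · have h3 : p.2 = 0 := by omega
        simp only [hT, h3, if_pos hn, hf0, map_zero]
    rw [h1, h2]
    calc n • a n = z n (T n) + (∑ p ∈ antidiagonal n, ⁅(T n p.1).1, a p.2⁆ +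
          ∑ p ∈ antidiagonal n, (T n p.1).2.2 (T n p.2).2.1) := by simp only [z]; abel
      _ = _ := by rw [h]; abel
  · rcases Nat.eq_zero_or_pos n with rfl | hn
    · simp [hu0]
    have hC : (F n).2.2 = C' n (T n) := by
      conv_lhs => rw [hF]
      simp [hn.ne', hT]
    have hn' : (n : K) ≠ 0 := Nat.cast_ne_zero.2 hn.ne'
    change n • (F n).2.2 y = ∑ p ∈ antidiagonal n, ⁅(F p.1).1, (F p.2).2.2 y⁆
    rw [hC, ← Nat.cast_smul_eq_nsmul K]
    simp only [C', LinearMap.smul_apply, smul_smul, mul_inv_cancel₀ hn', one_smul,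
      LinearMap.sum_apply, LinearMap.comp_apply]
    refine sum_congr rfl fun p hp => ?_
    rw [hu' n p hp]
    change ⁅(F p.1).1, (T n p.2).2.2 y⁆ = _
    have := mem_antidiagonal.1 hp
    rcases lt_or_eq_of_le (show p.2 ≤ n by omega) with h | h
    · simp only [hT, if_pos h]
    · have h3 : p.1 = 0 := by omega
      rw [h3, hu0, zero_lie, zero_lie]

end Centralizer

/-! ### Lifting elements of centralizers -/

section Lifting

open Finset

variable {K : Type*} [Field K] {L : Type*} [LieRing L] [LieAlgebra K L]

variable (K) in
/-- The power series of endomorphisms `∑ ad (a n) X ^ n`. -/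
noncomputable def adSeries (a : ℕ → L) : PowerSeries (Module.End K L) :=
  PowerSeries.mk fun n => LieAlgebra.ad K L (a n)

theorem coeff_adSeries (a : ℕ → L) (n : ℕ) :
    PowerSeries.coeff n (adSeries K a) = LieAlgebra.ad K L (a n) :=
  PowerSeries.coeff_mk _ _

theorem ad_lie_eq (x y : L) : LieAlgebra.ad K L ⁅x, y⁆ =
    (LieAlgebra.ad K L x : Module.End K L) * (LieAlgebra.ad K L y : Module.End K L) -
      (LieAlgebra.ad K L y : Module.End K L) * (LieAlgebra.ad K L x : Module.End K L) := by
  ext z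
  simp

theorem coeff_mul_sub_mul {R : Type*} [Ring R] (φ ψ : PowerSeries R) (n : ℕ) :
    PowerSeries.coeff n (φ * ψ - ψ * φ) = ∑ p ∈ antidiagonal n,
      (PowerSeries.coeff p.1 φ * PowerSeries.coeff p.2 ψ -
        PowerSeries.coeff p.2 ψ * PowerSeries.coeff p.1 φ) := by
  rw [map_sub, PowerSeries.coeff_mul, PowerSeries.coeff_mul, sum_sub_distrib]
  congr 1
  rw [← Finset.Nat.sum_antidiagonal_swap]
  rfl

theorem coeff_commutator_adSeries (a b : ℕ → L) (n : ℕ) :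
    PowerSeries.coeff n (adSeries K a * adSeries K b - adSeries K b * adSeries K a) =
      LieAlgebra.ad K L (∑ p ∈ antidiagonal n, ⁅a p.1, b p.2⁆) := by
  rw [coeff_mul_sub_mul, map_sum]
  simp only [coeff_adSeries, ad_lie_eq]

theorem euler_adSeries {a b c : ℕ → L}
    (h : ∀ n, n • a n = ∑ p ∈ antidiagonal n, ⁅b p.1, c p.2⁆) :
    euler (adSeries K a) = adSeries K b * adSeries K c - adSeries K c * adSeries K b := by
  ext1 n
  rw [coeff_commutator_adSeries, coeff_euler, coeff_adSeries, ← h, map_nsmul]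


theorem coeff_mul_sub_mul_congr {R : Type*} [Ring R] {φ φ' ψ : PowerSeries R} {n : ℕ}
    (h : ∀ i ≤ n, PowerSeries.coeff i φ = PowerSeries.coeff i φ') :
    PowerSeries.coeff n (φ * ψ - ψ * φ) = PowerSeries.coeff n (φ' * ψ - ψ * φ') := by
  rw [coeff_mul_sub_mul, coeff_mul_sub_mul]
  refine sum_congr rfl fun p hp => ?_
  rw [h p.1 (by have := mem_antidiagonal.1 hp; omega)]

/-- If the series `∑ C n y X ^ n` commute with `ψ`, so does `∑ X ^ j C (f j)`. -/
theorem commute_adSeries_antidiagonal {M : Type*} [AddCommGroup M] [Module K M]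
    {C : ℕ → M →ₗ[K] L} {ψ : PowerSeries (Module.End K L)}
    (h : ∀ y, Commute (adSeries K fun n => C n y) ψ) (f : ℕ → M) :
    Commute (adSeries K fun n => ∑ p ∈ antidiagonal n, C p.1 (f p.2)) ψ := by
  rw [commute_iff_eq, ← sub_eq_zero]
  ext1 n
  -- The infinite sum over `j` is replaced by its part with `j ≤ n`, which suffices for the
  -- coefficient of order `n`.
  have key : Commute (∑ j ∈ range (n + 1), PowerSeries.X ^ j * adSeries K fun n => C n (f j)) ψ :=
    Commute.sum_left _ _ _ fun j _ =>
      Commute.mul_left ((PowerSeries.commute_X_pow ψ j).symm) (h (f j))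
  rw [coeff_mul_sub_mul_congr (φ' := ∑ j ∈ range (n + 1),
    PowerSeries.X ^ j * adSeries K fun n => C n (f j)), sub_eq_zero.2 key.eq]
  intro i hi
  rw [coeff_adSeries, map_sum, map_sum]
  simp only [PowerSeries.coeff_X_pow_mul', coeff_adSeries]
  rw [← sum_filter, ← Finset.Nat.sum_antidiagonal_swap,
    Finset.Nat.sum_antidiagonal_eq_sum_range_succ_mk]
  refine sum_congr ?_ fun _ _ => rfl
  ext j
  simp only [mem_range, mem_filter]
  omega

/-- If `β` and `γ` commute with `α` up to order `N` and if `β` agrees up to order `N` with an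
element commuting with `α`, then the coefficient of `tr ([α, β] γ)` of order `2 N` vanishes. -/
theorem trace_coeff_commutator_mul_eq_zero {V : Type*} [AddCommGroup V] [Module K V]
    {N : ℕ} {α β γ c : PowerSeries (Module.End K V)}
    (hγ : ∀ n < N + 1, PowerSeries.coeff n (α * γ - γ * α) = 0) (hc : Commute α c)
    (hcβ : ∀ n < N + 1, PowerSeries.coeff n c = PowerSeries.coeff n β) :
    LinearMap.trace K V (PowerSeries.coeff (2 * N) ((α * β - β * α) * γ)) = 0 := by
  let τ : PowerSeries (Module.End K V) → K := fun φ =>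
    LinearMap.trace K V (PowerSeries.coeff (2 * N) φ)
  have hτ : ∀ φ ψ, τ (φ * ψ) = τ (ψ * φ) := by
    intro φ ψ
    simp only [τ, PowerSeries.coeff_mul, map_sum]
    rw [← Finset.Nat.sum_antidiagonal_swap]
    exact sum_congr rfl fun p _ => LinearMap.trace_mul_comm _ _ _
  have hsub : ∀ φ ψ, τ (φ - ψ) = τ φ - τ ψ := fun φ ψ => by simp [τ]
  obtain ⟨d, hd⟩ := (PowerSeries.X_pow_dvd_iff (φ := β - c) (n := N + 1)).2
    fun n hn => by rw [map_sub, hcβ n hn, sub_self]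
  obtain ⟨e, he⟩ := PowerSeries.X_pow_dvd_iff.2 hγ
  change τ _ = 0
  have hβ : β = c + PowerSeries.X ^ (N + 1) * d := by rw [← hd]; abel
  set X : PowerSeries (Module.End K V) := PowerSeries.X ^ (N + 1)
  have hX : ∀ φ, φ * X = X * φ := fun φ => (PowerSeries.commute_X_pow φ (N + 1)).eq
  -- With `β = c + X d` and `[α, γ] = X e`, where `X` stands for the power `N + 1` of the variable,
  -- what remains is a commutator, of trace zero, and a term of order at least `2 N + 2`.
  have h1 : (α * β - β * α) * γ = (α * (X * d * γ) - X * d * γ * α) - X * d * (X * e) := by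
    rw [← he, hβ]
    have := hc.eq
    calc _ = (α * c - c * α) * γ + (α * (X * d) - X * d * α) * γ := by noncomm_ring
      _ = (α * (X * d) - X * d * α) * γ := by rw [this, sub_self, zero_mul, zero_add]
      _ = _ := by noncomm_ring
  rw [h1, hsub, hsub, hτ, sub_self, zero_sub, neg_eq_zero]
  have h2 : X * d * (X * e) = PowerSeries.X ^ (N + 1 + (N + 1)) * (d * e) := by
    rw [pow_add, mul_assoc, ← mul_assoc d, hX d]
    simp only [X, mul_assoc]
  simp only [τ, h2]
  rw [PowerSeries.coeff_X_pow_mul', if_neg (by omega), map_zero]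

variable [CharZero K]

/-- Every element of the centralizer of a regular semisimple element `a 0` extends to a power
series commuting with `∑ a n X ^ n`. -/
theorem IsRegularSemisimple.exists_commute {a : ℕ → L} (ha : IsRegularSemisimple K (a 0)) :
    ∃ C : ℕ → centr K (a 0) →ₗ[K] L, (∀ y, C 0 y = y) ∧
      ∀ y, Commute (adSeries K a) (adSeries K fun n => C n y) := by
  have : IsAddTorsionFree (Module.End K L) := IsAddTorsionFree.of_isTorsionFree K (Module.End K L)
  obtain ⟨u, f, C, hu, hC, hEa, hEC⟩ := ha.exists_solution
  have hu0 : PowerSeries.coeff 0 (adSeries K u) = 0 := by rw [coeff_adSeries, hu, map_zero]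
  -- The commutator `w` of two such series solves `E w = [u, w]` by the Jacobi identity, and its
  -- initial value `⁅y, z⁆` is zero because the centralizer is commutative.
  have hcomm : ∀ y z, Commute (adSeries K fun n => C n y) (adSeries K fun n => C n z) := by
    intro y z
    rw [commute_iff_eq, ← sub_eq_zero]
    refine eq_zero_of_euler_eq hu0 ?_ ?_
    · rw [coeff_commutator_adSeries]
      simp [hC, ha.comm y z y.2 z.2]
    · rw [euler_commutator, euler_adSeries (b := u) (c := fun n => C n y) fun n => hEC n y,
        euler_adSeries (b := u) (c := fun n => C n z) fun n => hEC n z]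
      noncomm_ring
  refine ⟨C, hC, fun y => ?_⟩
  -- The inhomogeneous term `e` commutes with `c`, so `[a, c]` satisfies the same homogeneous
  -- equation.
  have he := (commute_adSeries_antidiagonal (fun z => hcomm z y) f).eq
  set e := adSeries K fun n => ∑ p ∈ antidiagonal n, C p.1 (f p.2)
  set c := adSeries K fun n => C n y with hc
  have hEa' : euler (adSeries K a) =
      adSeries K u * adSeries K a - adSeries K a * adSeries K u + e := by
    ext1 n
    rw [map_add, coeff_commutator_adSeries, coeff_euler, coeff_adSeries, coeff_adSeries,
      ← map_nsmul, hEa, map_add]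
  rw [commute_iff_eq, ← sub_eq_zero]
  refine eq_zero_of_euler_eq hu0 ?_ ?_
  · rw [hc, coeff_commutator_adSeries]
    simp only [Nat.antidiagonal_zero, sum_singleton, hC]
    rw [show ⁅a 0, (y : L)⁆ = 0 from y.2, map_zero]
  · rw [euler_commutator, hEa', hc,
      euler_adSeries (b := u) (c := fun n => C n y) fun n => hEC n y, ← hc]
    have : (adSeries K u * adSeries K a - adSeries K a * adSeries K u + e) * c -
        c * (adSeries K u * adSeries K a - adSeries K a * adSeries K u + e) =
        (adSeries K u * adSeries K a - adSeries K a * adSeries K u) * c -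
        c * (adSeries K u * adSeries K a - adSeries K a * adSeries K u) := by
      rw [add_mul, mul_add, he]
      abel
    rw [this]
    noncomm_ring

/-- An element commuting with `a` up to order `N` agrees up to order `N` with an element that
commutes with `a`. -/
theorem IsRegularSemisimple.exists_commute_of_forall_le {a : ℕ → L}
    (ha : IsRegularSemisimple K (a 0)) (hinj : Function.Injective (LieAlgebra.ad K L))
    (N : ℕ) (b : ℕ → L)
    (hb : ∀ n < N, ∑ p ∈ antidiagonal n, ⁅a p.1, b p.2⁆ = 0) :
    ∃ c : PowerSeries (Module.End K L), Commute (adSeries K a) c ∧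
      ∀ n < N, PowerSeries.coeff n c = LieAlgebra.ad K L (b n) := by
  obtain ⟨C, hC, hcomm⟩ := ha.exists_commute
  induction N generalizing b with
  | zero => exact ⟨0, Commute.zero_right _, fun n hn => absurd hn (Nat.not_lt_zero n)⟩
  | succ N ih =>
    have hb0 : ⁅a 0, b 0⁆ = 0 := by simpa using hb 0 (Nat.succ_pos N)
    let y : centr K (a 0) := ⟨b 0, hb0⟩
    have hCy : ∀ n, ∑ p ∈ antidiagonal n, ⁅a p.1, C p.2 y⁆ = 0 := by
      intro n
      refine (injective_iff_map_eq_zero _).1 hinj _ ?_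
      rw [← coeff_commutator_adSeries (b := fun n => C n y), (hcomm y).eq, sub_self, map_zero]
    -- Subtracting the lift of `b 0` leaves a series divisible by `X`; its quotient by `X` commutes
    -- with `a` to one order less.
    obtain ⟨c, hc, hcb⟩ := ih (fun n => b (n + 1) - C (n + 1) y) fun n hn => by
      have h := hb (n + 1) (by omega)
      have h' := hCy (n + 1)
      rw [Finset.Nat.sum_antidiagonal_succ'] at h h'
      simp only [lie_sub, sum_sub_distrib]
      rw [hC] at h'
      rw [eq_neg_of_add_eq_zero_right h, eq_neg_of_add_eq_zero_right h', sub_self]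
    refine ⟨adSeries K (fun n => C n y) + PowerSeries.X * c, (hcomm y).add_right
      (((PowerSeries.commute_X _)).mul_right hc), fun n hn => ?_⟩
    rcases n with _ | n
    · rw [map_add, coeff_adSeries, PowerSeries.coeff_zero_X_mul, add_zero, hC]
    · rw [map_add, coeff_adSeries, PowerSeries.coeff_succ_X_mul, hcb n (by omega), ← map_add]
      simp

end Lifting

/-! ### Evaluation of elements of a symmetric algebra at linear functionals -/

section Evaluation

variable {K : Type*} [Field K] {V : Type*} [AddCommGroup V] [Module K V]

/-- The value of an element of `S(V)` at a linear functional on `V`. -/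
noncomputable def evalAt (A : V →ₗ[K] K) : SymmetricAlgebra K V →ₐ[K] K :=
  SymmetricAlgebra.lift A

theorem evalAt_ι (A : V →ₗ[K] K) (v : V) : evalAt A (SymmetricAlgebra.ι K V v) = A v :=
  SymmetricAlgebra.lift_ι_apply _ _

/-- The differential of `F ∈ S(V)` at a functional `A`, as an element of `V`. -/
theorem exists_gradient (A : V →ₗ[K] K) (F : SymmetricAlgebra K V) :
    ∃ v : V, ∀ f : V →ₗ[K] SymmetricAlgebra K V, evalAt A (derivLift f F) = evalAt A (f v) := by
  induction F using SymmetricAlgebra.induction with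
  | algebraMap r => exact ⟨0, fun f => by simp⟩
  | ι x => exact ⟨x, fun f => by rw [derivLift_ι]⟩
  | mul a b ha hb =>
    obtain ⟨v, hv⟩ := ha
    obtain ⟨w, hw⟩ := hb
    refine ⟨evalAt A a • w + evalAt A b • v, fun f => ?_⟩
    simp [hv, hw]
  | add a b ha hb =>
    obtain ⟨v, hv⟩ := ha
    obtain ⟨w, hw⟩ := hb
    exact ⟨v + w, fun f => by simp [hv, hw]⟩

theorem eq_zero_of_evalAt_eq_zero [Infinite K] {P : SymmetricAlgebra K V}
    (h : ∀ A : V →ₗ[K] K, evalAt A P = 0) : P = 0 := by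
  let b := Module.Basis.ofVectorSpace K V
  let e := SymmetricAlgebra.equivMvPolynomial b
  refine (map_eq_zero_iff e e.injective).1 (MvPolynomial.funext fun x => ?_)
  rw [map_zero]
  have key : (MvPolynomial.aeval x).comp e.toAlgHom = evalAt (b.constr K x) := by
    apply SymmetricAlgebra.algHom_ext
    refine b.ext fun i => ?_
    simp [evalAt_ι, e]
  have := DFunLike.congr_fun key P
  rw [h] at this
  exact this

/-- A polynomial function on the dual of `V` that vanishes, on some line through every point, for
almost all points of that line, is zero. -/
theorem eq_zero_of_evalAt_line [Infinite K] {P : SymmetricAlgebra K V}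
    (h : ∀ A : V →ₗ[K] K, ∃ B : V →ₗ[K] K, {c : K | evalAt (A + c • B) P ≠ 0}.Finite) : P = 0 := by
  refine eq_zero_of_evalAt_eq_zero fun A => ?_
  obtain ⟨B, hB⟩ := h A
  -- Restriction of polynomial functions to the line `A + X B`.
  let φ : SymmetricAlgebra K V →ₐ[K] Polynomial K := SymmetricAlgebra.lift
    { toFun := fun v => Polynomial.C (A v) + Polynomial.X * Polynomial.C (B v)
      map_add' := fun v w => by simp only [map_add]; ring
      map_smul' := fun c v => by
        simp only [map_smul, smul_eq_mul, Polynomial.C_mul, RingHom.id_apply,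
          Polynomial.smul_eq_C_mul]
        ring }
  have hφ : ∀ c, (φ P).eval c = evalAt (A + c • B) P := by
    intro c
    have : (Polynomial.aeval c).comp φ = evalAt (A + c • B) := by
      apply SymmetricAlgebra.algHom_ext
      ext v
      simp [evalAt_ι, φ]
      exact mul_comm _ _
    exact DFunLike.congr_fun this P
  have h0 : φ P = 0 := by
    refine Polynomial.eq_zero_of_infinite_isRoot _ (hB.infinite_compl.mono fun c hc => ?_)
    rw [Set.mem_ofPred_eq, Polynomial.IsRoot, hφ]
    simpa using hc
  simpa [h0] using (hφ 0).symm

end Evaluation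

/-! ### The Poisson bracket in terms of differentials -/

section LiePoisson

variable {K : Type*} [Field K] {L : Type*} [LieRing L] [LieAlgebra K L]

theorem evalAt_poisson (A : L →ₗ[K] K) {F G : SymmetricAlgebra K L} {v w : L}
    (hv : ∀ f : L →ₗ[K] SymmetricAlgebra K L, evalAt A (derivLift f F) = evalAt A (f v))
    (hw : ∀ f : L →ₗ[K] SymmetricAlgebra K L, evalAt A (derivLift f G) = evalAt A (f w)) :
    evalAt A (poisson F G) = A ⁅v, w⁆ := by
  rw [poisson, hv]
  change evalAt A (derivLift _ G) = _
  rw [hw]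
  exact evalAt_ι A _

end LiePoisson

/-! ### Eigenspaces of automorphisms of finite order -/

section Eigen

open Finset

variable {K : Type*} [Field K] {V : Type*} [AddCommGroup V] [Module K V]

/-- The projection `m⁻¹ ∑ ζ ^ (- i j) T ^ j`, `0 ≤ j < m`, to the eigenspace of `T` for the
eigenvalue `ζ ^ i`, where `T ^ m = 1`. -/
noncomputable def eigenProj (m : ℕ) (ζ : Kˣ) (T : V →ₗ[K] V) (i : ℤ) : V →ₗ[K] V :=
  (m : K)⁻¹ • ∑ j ∈ range m, ((ζ ^ (-(i * j)) : Kˣ) : K) • T ^ j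

theorem eigenProj_apply (m : ℕ) (ζ : Kˣ) (T : V →ₗ[K] V) (i : ℤ) (v : V) :
    eigenProj m ζ T i v =
      (m : K)⁻¹ • ∑ j ∈ range m, ((ζ ^ (-(i * j)) : Kˣ) : K) • (T ^ j) v := by
  simp [eigenProj]

variable {m : ℕ} {ζ : Kˣ} {T : V →ₗ[K] V}

theorem eigenProj_apply_map (hζ : ζ ^ m = 1) (hT : T ^ m = 1) (i : ℤ) (v : V) :
    eigenProj m ζ T i (T v) = ((ζ ^ i : Kˣ) : K) • eigenProj m ζ T i v := by
  rw [eigenProj_apply, eigenProj_apply, smul_comm]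
  congr 1
  have h : ∀ j, ((ζ ^ (-(i * (j : ℕ))) : Kˣ) : K) • (T ^ j) (T v) =
      ((ζ ^ i : Kˣ) : K) • ((ζ ^ (-(i * (j + 1 : ℕ))) : Kˣ) : K) • (T ^ (j + 1)) v := by
    intro j
    rw [smul_smul, ← Units.val_mul, ← zpow_add, pow_succ]
    congr 4
    push_cast
    ring
  simp only [h]
  rw [← smul_sum]
  congr 1
  -- The shifted sum differs from the original by its end terms `j = m` and `j = 0`, which agree
  -- since `ζ ^ m = 1` and `T ^ m = 1`.
  rw [← add_left_inj, ← sum_range_succ' fun j => ((ζ ^ (-(i * (j : ℕ))) : Kˣ) : K) • (T ^ j) v,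
    sum_range_succ]
  congr 1
  rw [hT, ← mul_neg, mul_comm, zpow_mul]
  simp [hζ]

theorem map_eigenProj_apply (hζ : ζ ^ m = 1) (hT : T ^ m = 1) (i : ℤ) (v : V) :
    T (eigenProj m ζ T i v) = ((ζ ^ i : Kˣ) : K) • eigenProj m ζ T i v := by
  rw [← eigenProj_apply_map hζ hT, eigenProj_apply, eigenProj_apply]
  simp only [map_smul, map_sum]
  congr 1
  refine sum_congr rfl fun j _ => ?_
  rw [← Module.End.mul_apply, ← Module.End.mul_apply, ← pow_succ, ← pow_succ']

theorem pow_apply_of_eigen {c : Kˣ} {v : V} (hv : T v = (c : K) • v) (j : ℕ) :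
    (T ^ j) v = ((c ^ j : Kˣ) : K) • v := by
  induction j with
  | zero => simp
  | succ j ih => rw [pow_succ, Module.End.mul_apply, hv, map_smul, ih, smul_smul, pow_succ',
      Units.val_mul]

variable [CharZero K]

theorem eigenProj_apply_of_eigen (hm : 0 < m) {i : ℤ} {v : V}
    (hv : T v = ((ζ ^ i : Kˣ) : K) • v) : eigenProj m ζ T i v = v := by
  have hm' : (m : K) ≠ 0 := Nat.cast_ne_zero.2 hm.ne'
  rw [eigenProj_apply]
  have h : ∀ j, ((ζ ^ (-(i * (j : ℕ))) : Kˣ) : K) • (T ^ j) v = v := by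
    intro j
    rw [pow_apply_of_eigen hv, smul_smul, ← Units.val_mul, ← zpow_natCast, ← zpow_mul,
      ← zpow_add]
    simp
  simp only [h, sum_const, card_range, ← Nat.cast_smul_eq_nsmul K, smul_smul,
    inv_mul_cancel₀ hm', one_smul]

/-- Orthogonality of characters: for `0 < j < m` the sum of the powers of `ζ ^ (-j)` is a vanishing
geometric sum, so only `T ^ 0` survives. -/
theorem sum_eigenProj (hm : 0 < m) (hζ : IsPrimitiveRoot (ζ : K) m) (v : V) :
    ∑ i ∈ range m, eigenProj m ζ T i v = v := by
  have hm' : (m : K) ≠ 0 := Nat.cast_ne_zero.2 hm.ne'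
  simp only [eigenProj_apply]
  rw [← smul_sum, sum_comm]
  have h : ∀ j ∈ range m, ∑ i ∈ range m, ((ζ ^ (-((i : ℤ) * (j : ℕ))) : Kˣ) : K) • (T ^ j) v =
      if j = 0 then (m : K) • v else 0 := by
    intro j hj
    rw [← sum_smul]
    split_ifs with h0
    · simp [h0]
    · have hζ' : IsPrimitiveRoot ((ζ⁻¹ : Kˣ) : K) m := by
        rw [Units.val_inv_eq_inv_val]; exact hζ.inv
      have hne : (((ζ⁻¹ : Kˣ) : K) ^ j) ≠ 1 :=
        fun h => h0 (Nat.eq_zero_of_dvd_of_lt (hζ'.dvd_of_pow_eq_one j h) (mem_range.1 hj))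
      have hsum : ∑ i ∈ range m, ((ζ ^ (-((i : ℤ) * (j : ℕ))) : Kˣ) : K) =
          ∑ i ∈ range m, (((ζ⁻¹ : Kˣ) : K) ^ j) ^ i := by
        refine sum_congr rfl fun i _ => ?_
        rw [← pow_mul, ← Units.val_pow_eq_pow_val, ← zpow_natCast, inv_zpow']
        congr 2
        push_cast
        ring
      have hgeom := mul_neg_geom_sum (((ζ⁻¹ : Kˣ) : K) ^ j) m
      rw [← pow_mul, mul_comm j, pow_mul, hζ'.pow_eq_one, one_pow, sub_self] at hgeom
      rw [hsum, (mul_eq_zero.1 hgeom).resolve_left (sub_ne_zero.2 hne.symm), zero_smul]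
  rw [sum_congr rfl h, sum_ite_eq' (range m) 0, if_pos (mem_range.2 hm), smul_smul,
    inv_mul_cancel₀ hm', one_smul]

end Eigen

/-! ### Solvability criteria -/

section Solvable

variable {K : Type*} [Field K] {L : Type*} [LieRing L] [LieAlgebra K L]

theorem lieEquiv_pow_apply_lie (θ : L ≃ₗ⁅K⁆ L) (j : ℕ) (x y : L) :
    ((θ.toLinearEquiv : L →ₗ[K] L) ^ j) ⁅x, y⁆ =
      ⁅((θ.toLinearEquiv : L →ₗ[K] L) ^ j) x, ((θ.toLinearEquiv : L →ₗ[K] L) ^ j) y⁆ := by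
  induction j with
  | zero => rfl
  | succ j ih =>
    simp only [pow_succ', Module.End.mul_apply, ih]
    exact LieEquiv.map_lie θ _ _

/-- The fixed points of an automorphism. -/
def fixedPoints (θ : L ≃ₗ⁅K⁆ L) : LieSubalgebra K L where
  carrier := {x | θ x = x}
  add_mem' hx hy := by
    simp only [Set.mem_ofPred_eq] at hx hy ⊢
    rw [map_add, hx, hy]
  zero_mem' := map_zero θ
  smul_mem' c x hx := by
    simp only [Set.mem_ofPred_eq] at hx ⊢
    rw [map_smul, hx]
  lie_mem' hx hy := by
    simp only [Set.mem_ofPred_eq] at hx hy ⊢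
    rw [LieEquiv.map_lie, hx, hy]

/-- The quotient map by an ideal, as a homomorphism of Lie algebras. -/
def quotientHom (I : LieIdeal K L) : L →ₗ⁅K⁆ L ⧸ I where
  __ := (LieSubmodule.Quotient.mk' I : L →ₗ[K] L ⧸ I)
  map_lie' := LieSubmodule.Quotient.mk_bracket I _ _

theorem quotientHom_surjective (I : LieIdeal K L) : Function.Surjective (quotientHom I) :=
  LieSubmodule.Quotient.surjective_mk' I

theorem quotientHom_eq_zero {I : LieIdeal K L} {x : L} : quotientHom I x = 0 ↔ x ∈ I :=
  LieSubmodule.Quotient.mk_eq_zero I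

theorem isSolvable_of_ker {L' : Type*} [LieRing L'] [LieAlgebra K L'] (f : L →ₗ⁅K⁆ L')
    [LieAlgebra.IsSolvable L'] [LieAlgebra.IsSolvable f.ker] : LieAlgebra.IsSolvable L := by
  obtain ⟨k, hk⟩ := LieAlgebra.IsSolvable.solvable K L'
  obtain ⟨l, hl⟩ := LieAlgebra.IsSolvable.solvable K f.ker
  rw [LieIdeal.derivedSeries_eq_bot_iff] at hl
  have hle : LieAlgebra.derivedSeries K L k ≤ f.ker := by
    have := LieIdeal.derivedSeries_map_le (f := f) k
    rw [hk] at this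
    exact (LieIdeal.map_eq_bot_iff).1 (le_bot_iff.1 this)
  refine LieAlgebra.IsSolvable.mk (R := K) (k := l + k) ?_
  rw [LieAlgebra.derivedSeries_def, LieAlgebra.derivedSeriesOfIdeal_add, eq_bot_iff, ← hl]
  exact LieAlgebra.derivedSeriesOfIdeal_mono hle l

variable [CharZero K] [FiniteDimensional K L]

/-- If the fixed points of an automorphism of finite order act nilpotently, they lie in the
radical of the Killing form. -/
theorem mem_killingCompl_of_fixed {m : ℕ} (hm : 0 < m) {ζ : Kˣ}
    (hζ : IsPrimitiveRoot (ζ : K) m) (θ : L ≃ₗ⁅K⁆ L)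
    (hθ : (θ.toLinearEquiv : L →ₗ[K] L) ^ m = 1)
    (hnil : ∀ x, θ x = x → IsNilpotent (LieAlgebra.ad K L x)) {x : L} (hx : θ x = x) :
    x ∈ LieIdeal.killingCompl K L ⊤ := by
  have hζm : ζ ^ m = 1 := Units.ext (by simpa using hζ.pow_eq_one)
  have hmod : LieModule.IsNilpotent (fixedPoints θ) L :=
    LieModule.isNilpotent_iff_forall'.2 fun y => hnil y y.2
  rw [LieIdeal.mem_killingCompl]
  intro y _
  rw [← sum_eigenProj (T := (θ.toLinearEquiv : L →ₗ[K] L)) hm hζ y, map_sum,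
    LinearMap.sum_apply]
  refine Finset.sum_eq_zero fun i hi => ?_
  have hy : θ (eigenProj m ζ (θ.toLinearEquiv : L →ₗ[K] L) i y) =
      ((ζ ^ (i : ℤ) : Kˣ) : K) • eigenProj m ζ (θ.toLinearEquiv : L →ₗ[K] L) i y :=
    map_eigenProj_apply hζm hθ i y
  set z := eigenProj m ζ (θ.toLinearEquiv : L →ₗ[K] L) i y
  -- For `i = 0` both arguments lie in the fixed subalgebra, which acts nilpotently by Engel's
  -- theorem, so its trace form is zero. For `i > 0` invariance of the Killing form under `θ` gives
  -- a factor `ζ ^ i ≠ 1`.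
  rcases Nat.eq_zero_or_pos i with rfl | hi0
  · have hz : θ z = z := by simpa using hy
    have h := LieModule.traceForm_eq_zero_of_isNilpotent K (fixedPoints θ) L
    exact LinearMap.congr_fun₂ h ⟨z, hz⟩ ⟨x, hx⟩
  · have h := LieAlgebra.killingForm_of_equiv_apply θ z x
    rw [hy, hx, map_smul, LinearMap.smul_apply, smul_eq_mul] at h
    have hne : ((ζ ^ (i : ℤ) : Kˣ) : K) ≠ 1 := by
      rw [zpow_natCast, Units.val_pow_eq_pow_val]
      exact hζ.pow_ne_one_of_pos_of_lt hi0.ne' (Finset.mem_range.1 hi)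
    have h' : (((ζ ^ (i : ℤ) : Kˣ) : K) - 1) * killingForm K L z x = 0 := by
      rw [sub_mul, h, one_mul, sub_self]
    exact (mul_eq_zero.1 h').resolve_left (sub_ne_zero.2 hne)

theorem pow_val_add {K : Type*} [Field K] {m : ℕ} [NeZero m] {ζ : Kˣ} (hζ : ζ ^ m = 1) (i j : ZMod m) :
    ζ ^ (i + j).val = ζ ^ i.val * ζ ^ j.val := by
  rw [← pow_add, ZMod.val_add, ← pow_mod_orderOf ζ (i.val + j.val),
    ← pow_mod_orderOf ζ ((i.val + j.val) % m),
    Nat.mod_mod_of_dvd _ (orderOf_dvd_of_pow_eq_one hζ)]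

/-- A Lie algebra with an automorphism of finite order whose fixed points act nilpotently is
solvable. -/
theorem isSolvable_of_fixed_nilpotent {m : ℕ} (hm : 0 < m) {ζ : Kˣ}
    (hζ : IsPrimitiveRoot (ζ : K) m) (θ : L ≃ₗ⁅K⁆ L)
    (hθ : (θ.toLinearEquiv : L →ₗ[K] L) ^ m = 1)
    (hnil : ∀ x, θ x = x → IsNilpotent (LieAlgebra.ad K L x)) : LieAlgebra.IsSolvable L := by
  have hζm : ζ ^ m = 1 := Units.ext (by simpa using hζ.pow_eq_one)
  have : NeZero m := ⟨hm.ne'⟩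
  -- The radical `R` of the Killing form is solvable by Cartan's criterion. It contains all fixed
  -- points, so the images of the eigenspaces grade `L ⧸ R` with zero component in degree `0`, and
  -- Kreknin's theorem applies to the quotient.
  let R := LieIdeal.killingCompl K L ⊤
  have hR : LieAlgebra.IsSolvable R :=
    (LieAlgebra.LieIdeal.solvable_iff_le_radical K L R).2 (LieAlgebra.killingCompl_top_le_radical K L)
  let π : L →ₗ[K] L ⧸ R := (quotientHom R : L →ₗ[K] L ⧸ R)
  let W : ZMod m → Submodule K (L ⧸ R) := fun i =>
    (LinearMap.ker ((θ.toLinearEquiv : L →ₗ[K] L) - ((ζ ^ i.val : Kˣ) : K) • LinearMap.id)).map π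
  have hmem : ∀ (i : ZMod m) (z : L ⧸ R), z ∈ W i ↔
      ∃ x, θ x = ((ζ ^ i.val : Kˣ) : K) • x ∧ π x = z := by
    intro i z
    simp only [W, Submodule.mem_map, LinearMap.mem_ker, LinearMap.sub_apply, sub_eq_zero]
    rfl
  have hW : IsGradedWithoutZero W := by
    refine ⟨fun i j z hz w hw => ?_, fun z hz => ?_⟩
    · obtain ⟨x, hx, rfl⟩ := (hmem i z).1 hz
      obtain ⟨y, hy, rfl⟩ := (hmem j w).1 hw
      refine (hmem _ _).2 ⟨⁅x, y⁆, ?_, rfl⟩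
      rw [LieEquiv.map_lie, hx, hy, pow_val_add hζm, smul_lie, lie_smul, smul_smul,
        Units.val_mul]
    · obtain ⟨x, hx, rfl⟩ := (hmem 0 z).1 hz
      refine quotientHom_eq_zero.2 ?_
      exact mem_killingCompl_of_fixed hm hζ θ hθ hnil (by simpa using hx)
  have htop : ⨆ i, W i = ⊤ := by
    rw [eq_top_iff]
    rintro z -
    obtain ⟨x, rfl⟩ := quotientHom_surjective R z
    change π x ∈ _
    rw [← sum_eigenProj (T := (θ.toLinearEquiv : L →ₗ[K] L)) hm hζ x, map_sum]
    refine Submodule.sum_mem _ fun i hi => Submodule.mem_iSup_of_mem (i : ZMod m) ?_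
    refine (hmem _ _).2 ⟨_, ?_, rfl⟩
    rw [ZMod.val_cast_of_lt (Finset.mem_range.1 hi)]
    exact map_eigenProj_apply hζm hθ i x
  have hQ : LieAlgebra.IsSolvable (L ⧸ R) := hW.isSolvable htop
  have hker : (quotientHom R).ker = R := by
    ext x
    rw [LieHom.mem_ker, quotientHom_eq_zero]
  have : LieAlgebra.IsSolvable (quotientHom R).ker := by rw [hker]; exact hR
  exact isSolvable_of_ker (quotientHom R)

end Solvable

/-! ### Solvable Lie algebras of endomorphisms -/

section LieTrace

variable {K : Type*} [Field K] [CharZero K] [IsAlgClosed K] {L : Type*} [LieRing L]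
  [LieAlgebra K L] [LieAlgebra.IsSolvable L]

/-- For a solvable Lie algebra, the operators `[u, v] w` are nilpotent. -/
theorem isNilpotent_toEnd_lie_mul (d : ℕ) (M : Type*) [AddCommGroup M] [Module K M]
    [LieRingModule L M] [LieModule K L M] [FiniteDimensional K M] [FiniteDimensional K L]
    (hd : Module.finrank K M ≤ d) (u v w : L) :
    ∃ k : ℕ, (LieModule.toEnd K L M ⁅u, v⁆ * LieModule.toEnd K L M w) ^ k = 0 := by
  induction d generalizing M with
  | zero =>
    have : Subsingleton M := Module.finrank_zero_iff.1 (Nat.le_zero.1 hd)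
    exact ⟨0, LinearMap.ext fun x => Subsingleton.elim _ _⟩
  | succ d ih =>
    rcases subsingleton_or_nontrivial M with hM | hM
    · exact ⟨0, LinearMap.ext fun x => Subsingleton.elim _ _⟩
    -- Lie's theorem: a common eigenvector `e` spans a submodule, and the induction passes to the
    -- quotient by it.
    obtain ⟨χ, hχ⟩ := LieModule.exists_nontrivial_weightSpace_of_isSolvable K L M
    obtain ⟨⟨e, he⟩, he0⟩ := exists_ne (0 : LieModule.weightSpace M χ)
    rw [LieModule.mem_weightSpace] at he
    have he0' : e ≠ 0 := fun h => he0 (Subtype.ext h)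
    let N : LieSubmodule K L M :=
      { Submodule.span K {e} with
        lie_mem := by
          intro y n hn
          obtain ⟨c, rfl⟩ := Submodule.mem_span_singleton.1 hn
          rw [lie_smul, he]
          exact Submodule.smul_mem _ _ (Submodule.smul_mem _ _ (Submodule.mem_span_singleton_self e)) }
    have hN : ∀ n, n ∈ N ↔ ∃ c : K, c • e = n := fun n => Submodule.mem_span_singleton
    have hlt : Module.finrank K (M ⧸ N) ≤ d := by
      have h1 := Submodule.finrank_quotient_add_finrank (N : Submodule K M)
      have h2 : 0 < Module.finrank K (N : Submodule K M) := by
        rw [Module.finrank_pos_iff]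
        exact ⟨⟨⟨e, (hN e).2 ⟨1, one_smul _ _⟩⟩, 0, fun h => he0' (congrArg Subtype.val h)⟩⟩
      change Module.finrank K (M ⧸ (N : Submodule K M)) ≤ d
      omega
    obtain ⟨k, hk⟩ := ih (M ⧸ N) hlt
    set T := LieModule.toEnd K L M ⁅u, v⁆ * LieModule.toEnd K L M w with hT
    have hmk : ∀ (j : ℕ) (x : M), (LieSubmodule.Quotient.mk ((T ^ j) x) : M ⧸ N) =
        ((LieModule.toEnd K L (M ⧸ N) ⁅u, v⁆ * LieModule.toEnd K L (M ⧸ N) w) ^ j)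
          (LieSubmodule.Quotient.mk x) := by
      intro j
      induction j with
      | zero => intro x; rfl
      | succ j ihj =>
        intro x
        rw [pow_succ, Module.End.mul_apply, ihj, pow_succ, Module.End.mul_apply]
        rfl
    refine ⟨k + 1, LinearMap.ext fun x => ?_⟩
    have hx : (T ^ k) x ∈ N := by
      rw [← LieSubmodule.Quotient.mk_eq_zero', hmk, hk]
      rfl
    obtain ⟨c, hc⟩ := (hN _).1 hx
    -- On the line of `e` everything acts by scalars, so `⁅u, v⁆` acts by zero there and one more
    -- factor kills the vector.
    rw [pow_succ', Module.End.mul_apply, ← hc, hT]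
    simp [he, smul_smul, mul_comm]

theorem trace_toEnd_lie_mul (M : Type*) [AddCommGroup M] [Module K M]
    [LieRingModule L M] [LieModule K L M] [FiniteDimensional K M] [FiniteDimensional K L]
    (u v w : L) :
    LinearMap.trace K M (LieModule.toEnd K L M ⁅u, v⁆ * LieModule.toEnd K L M w) = 0 :=
  (LinearMap.isNilpotent_trace_of_isNilpotent
    (isNilpotent_toEnd_lie_mul _ M le_rfl u v w)).eq_zero

end LieTrace

/-! ### Regular elements among the fixed points of an automorphism -/

section Regular

variable {K : Type*} [Field K] {L : Type*} [LieRing L] [LieAlgebra K L]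

/-- Invariance of the Killing form, iterated. It makes the Engel subalgebra of `x` orthogonal to the
other Fitting component of `ad x`. -/
theorem killingForm_pow_ad (x y z : L) (k : ℕ) :
    killingForm K L y ((LieAlgebra.ad K L x ^ k) z) =
      (-1) ^ k * killingForm K L ((LieAlgebra.ad K L x ^ k) y) z := by
  induction k generalizing y z with
  | zero => simp
  | succ k ih =>
    have h : (LieAlgebra.ad K L x ^ (k + 1)) y = ⁅x, (LieAlgebra.ad K L x ^ k) y⁆ := by
      rw [pow_succ', Module.End.mul_apply, LieAlgebra.ad_apply]
    rw [h, pow_succ, Module.End.mul_apply, ih, LieAlgebra.ad_apply,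
      ← LieModule.traceForm_apply_lie_apply, ← lie_skew, map_neg, LinearMap.neg_apply, pow_succ]
    ring

variable [FiniteDimensional K L]

variable (K) in
-- Fitting's decomposition for `ad x`; the exponent stays free so that it can be enlarged later.
theorem exists_codisjoint_engel (x : L) : ∃ n : ℕ, ∀ k ≥ n, ∀ z : L,
    ∃ y ∈ LieSubalgebra.engel K x, ∃ w : L, z = y + (LieAlgebra.ad K L x ^ k) w := by
  obtain ⟨n, hn⟩ := Filter.eventually_atTop.1
    (LinearMap.eventually_codisjoint_ker_pow_range_pow (LieAlgebra.ad K L x))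
  refine ⟨n, fun k hk z => ?_⟩
  have hz : z ∈ LinearMap.ker (LieAlgebra.ad K L x ^ k) ⊔
      LinearMap.range (LieAlgebra.ad K L x ^ k) := by
    rw [(hn k hk).eq_top]
    trivial
  obtain ⟨y, hy, _, ⟨w, rfl⟩, rfl⟩ := Submodule.mem_sup.1 hz
  exact ⟨y, (LieSubalgebra.mem_engel_iff K x y).2 ⟨k, hy⟩, w, rfl⟩

/-- The adjoint action of the fixed points of an automorphism, as a linear family of
endomorphisms. -/
noncomputable abbrev fixedAd (θ : L ≃ₗ⁅K⁆ L) : fixedPoints θ →ₗ[K] Module.End K L :=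
  (LieAlgebra.ad K L : L →ₗ[K] Module.End K L) ∘ₗ (fixedPoints θ).toSubmodule.subtype

/-- For a regular element `x` of the algebra of fixed points, the fixed points in the Engel
subalgebra of `x` act nilpotently on it. -/
theorem engel_le_engel_of_isNilRegular [Infinite K] {θ : L ≃ₗ⁅K⁆ L} {x : fixedPoints θ}
    (hx : LinearMap.IsNilRegular (fixedAd θ) x) {y : L} (hy : θ y = y)
    (hyx : y ∈ LieSubalgebra.engel K (x : L)) :
    LieSubalgebra.engel K (x : L) ≤ LieSubalgebra.engel K y := by
  let U : LieSubalgebra K L := fixedPoints θ ⊓ LieSubalgebra.engel K (x : L)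
  let E : {LieSubalgebra.engel K z | z ∈ U} :=
    ⟨_, x, ⟨x.2, LieSubalgebra.self_mem_engel K _⟩, rfl⟩
  have hcard : (Module.finrank K L : Cardinal) ≤ Cardinal.mk K :=
    Cardinal.natCast_le_aleph0.trans (Cardinal.infinite_iff.1 inferInstance)
  suffices IsBot E from this ⟨_, y, ⟨hy, hyx⟩, rfl⟩
  -- Among the Engel subalgebras of elements of `U`, a minimal one containing `U` is the smallest.
  -- Minimality holds because the dimension of an Engel subalgebra is the trailing degree of a
  -- characteristic polynomial, which is least at a nil-regular element.
  refine LieAlgebra.engel_isBot_of_isMin hcard U E (fun z hz => hz.2) ?_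
  rintro ⟨_, z, hz, rfl⟩ hzx
  change LieSubalgebra.engel K z ≤ LieSubalgebra.engel K (x : L) at hzx
  change LieSubalgebra.engel K (x : L) ≤ LieSubalgebra.engel K z
  suffices h : Module.finrank K (LieSubalgebra.engel K (x : L)) ≤
      Module.finrank K (LieSubalgebra.engel K z) by
    suffices LieSubalgebra.engel K z = LieSubalgebra.engel K (x : L) from this.ge
    apply LieSubalgebra.toSubmodule_injective
    exact Submodule.eq_of_le_of_finrank_le hzx h
  rw [LieAlgebra.finrank_engel, LieAlgebra.finrank_engel]
  have h1 := (LinearMap.isNilRegular_iff_natTrailingDegree_charpoly_eq_nilRank _ _).1 hx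
  have h2 := LinearMap.nilRank_le_natTrailingDegree_charpoly (fixedAd θ) ⟨z, hz.1⟩
  exact h1.le.trans h2

theorem map_engel_eq (θ : L ≃ₗ⁅K⁆ L) {x : L} (hx : θ x = x) :
    (LieSubalgebra.engel K x).map (θ : L →ₗ⁅K⁆ L) = LieSubalgebra.engel K x := by
  have hpow : ∀ (k : ℕ) z, (LieAlgebra.ad K L x ^ k) (θ z) = θ ((LieAlgebra.ad K L x ^ k) z) := by
    intro k z
    induction k with
    | zero => rfl
    | succ k ih =>
      rw [pow_succ', Module.End.mul_apply, Module.End.mul_apply, ih, LieAlgebra.ad_apply,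
        LieAlgebra.ad_apply, LieEquiv.map_lie, hx]
  apply LieSubalgebra.toSubmodule_injective
  refine Submodule.eq_of_le_of_finrank_le ?_ ?_
  · rintro _ ⟨z, hz, rfl⟩
    obtain ⟨k, hk⟩ := (LieSubalgebra.mem_engel_iff K x z).1 hz
    refine (LieSubalgebra.mem_engel_iff K x _).2 ⟨k, ?_⟩
    change (LieAlgebra.ad K L x ^ k) (θ z) = 0
    rw [hpow, hk, map_zero]
  · exact (LinearEquiv.finrank_map_eq θ.toLinearEquiv
      (LieSubalgebra.engel K x).toSubmodule).ge

/-- A regular element of the algebra of fixed points of an automorphism of finite order of a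
semisimple Lie algebra is regular semisimple. -/
theorem isRegularSemisimple_of_isNilRegular [CharZero K] [IsAlgClosed K] [LieAlgebra.IsKilling K L]
    {m : ℕ} (hm : 0 < m) {ζ : Kˣ} (hζ : IsPrimitiveRoot (ζ : K) m) {θ : L ≃ₗ⁅K⁆ L}
    (hθ : (θ.toLinearEquiv : L →ₗ[K] L) ^ m = 1) {x : fixedPoints θ}
    (hx : LinearMap.IsNilRegular (fixedAd θ) x) : IsRegularSemisimple K (x : L) := by
  set N := LieSubalgebra.engel K (x : L) with hN
  have hθx : θ (x : L) = x := x.2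
  let θN : N ≃ₗ⁅K⁆ N := LieEquiv.ofSubalgebras N N θ (map_engel_eq θ hθx)
  have hθN : (θN.toLinearEquiv : N →ₗ[K] N) ^ m = 1 := by
    have h : ∀ (k : ℕ) (z : N), (((θN.toLinearEquiv : N →ₗ[K] N) ^ k) z : L) =
        ((θ.toLinearEquiv : L →ₗ[K] L) ^ k) z := by
      intro k z
      induction k with
      | zero => rfl
      | succ k ih =>
        rw [pow_succ', Module.End.mul_apply, pow_succ', Module.End.mul_apply, ← ih]
        rfl
    ext z
    rw [h, hθ]
    rfl
  have hsolv : LieAlgebra.IsSolvable N := by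
    refine isSolvable_of_fixed_nilpotent hm hζ θN hθN fun y hy => ?_
    have hy' : θ (y : L) = y := congrArg Subtype.val hy
    have hle := engel_le_engel_of_isNilRegular hx hy' y.2
    have hnil : ∀ z : N, ∃ k, (LieAlgebra.ad K N y ^ k) z = 0 := by
      intro z
      obtain ⟨k, hk⟩ := (LieSubalgebra.mem_engel_iff K _ _).1 (hle z.2)
      refine ⟨k, Subtype.ext ?_⟩
      have h : ∀ k : ℕ, (((LieAlgebra.ad K N y ^ k) z : N) : L) =
          (LieAlgebra.ad K L (y : L) ^ k) z := by
        intro k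
        induction k with
        | zero => rfl
        | succ k ih =>
          rw [pow_succ', Module.End.mul_apply, pow_succ', Module.End.mul_apply, ← ih]
          rfl
      rw [h, hk]
      rfl
    exact Module.End.isNilpotent_iff_of_finite.2 hnil
  obtain ⟨n, hn⟩ := exists_codisjoint_engel K (x : L)
  -- `⁅u, v⁆` is orthogonal to `N` because `N` is solvable and acts on `L`, and to the range of a
  -- high power of `ad x` by invariance. Hence it lies in the kernel of the Killing form.
  have habel : ∀ u ∈ N, ∀ v ∈ N, ⁅u, v⁆ = 0 := by
    intro u hu v hv
    have hker : ∀ z, killingForm K L ⁅u, v⁆ z = 0 := by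
      intro z
      obtain ⟨k₀, hk₀⟩ := (LieSubalgebra.mem_engel_iff K _ _).1 (N.lie_mem hu hv)
      obtain ⟨y, hy, w, rfl⟩ := hn (max n k₀) (le_max_left _ _) z
      rw [map_add, killingForm_pow_ad, Module.End.pow_map_zero_of_le (le_max_right _ _) hk₀,
        map_zero, LinearMap.zero_apply, mul_zero, add_zero]
      exact trace_toEnd_lie_mul (K := K) L (⟨u, hu⟩ : N) ⟨v, hv⟩ ⟨y, hy⟩
    have : ⁅u, v⁆ ∈ LinearMap.ker (killingForm K L) := LinearMap.ext hker
    rwa [LieAlgebra.IsKilling.ker_killingForm_eq_bot] at this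
  have hmem : ∀ y, ⁅(x : L), y⁆ = 0 → y ∈ N := fun y hy =>
    (LieSubalgebra.mem_engel_iff K _ _).2 ⟨1, by simpa using hy⟩
  refine ⟨fun y z hy hz => habel y (hmem y hy) z (hmem z hz), fun z => ?_⟩
  obtain ⟨y, hy, w, rfl⟩ := hn (n + 1) (Nat.le_succ n) z
  refine ⟨-(LieAlgebra.ad K L (x : L) ^ n) w, y,
    habel _ (LieSubalgebra.self_mem_engel K _) _ hy, ?_⟩
  rw [neg_lie, lie_skew, add_comm, pow_succ', Module.End.mul_apply, LieAlgebra.ad_apply]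

end Regular

/-! ### Genericity along a line -/

section Generic

variable {K : Type*} [Field K]

/-- Nil-regularity of a linear family is an open condition along lines. -/
theorem finite_not_isNilRegular {U M : Type*} [AddCommGroup U] [Module K U]
    [FiniteDimensional K U] [AddCommGroup M] [Module K M] [FiniteDimensional K M]
    (φ : U →ₗ[K] Module.End K M) {x₀ : U} (hx₀ : LinearMap.IsNilRegular φ x₀) (y : U) :
    {c : K | ¬ LinearMap.IsNilRegular φ (y + c • (x₀ - y))}.Finite := by
  let b := Module.Free.chooseBasis K U
  let Q := (LinearMap.polyCharpoly φ b).coeff (LinearMap.nilRank φ)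
  let q : Polynomial K := MvPolynomial.aeval
    (fun i => Polynomial.C (b.repr y i) + Polynomial.X * Polynomial.C (b.repr (x₀ - y) i)) Q
  have hq : ∀ c, q.eval c = MvPolynomial.eval (b.repr (y + c • (x₀ - y))) Q := by
    intro c
    have h : (Polynomial.aeval c).comp (MvPolynomial.aeval fun i => Polynomial.C (b.repr y i) +
        Polynomial.X * Polynomial.C (b.repr (x₀ - y) i)) =
        MvPolynomial.aeval (R := K) (b.repr (y + c • (x₀ - y))) := by
      ext i
      simp
    exact DFunLike.congr_fun h Q
  have hreg : ∀ c, LinearMap.IsNilRegular φ (y + c • (x₀ - y)) ↔ q.eval c ≠ 0 := fun c => by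
    rw [hq]
    exact LinearMap.isNilRegular_iff_coeff_polyCharpoly_nilRank_ne_zero φ b _
  have hq0 : q ≠ 0 := by
    intro h
    have := (hreg 1).1 (by simpa using hx₀)
    simp [h] at this
  refine (Polynomial.finite_setOfPred_isRoot hq0).subset fun c hc => ?_
  simpa [hreg] using hc

end Generic

/-! ### Functionals on brackets and inner derivations -/

section Cocycle

variable {K : Type*} [Field K] {g : Type*} [LieRing g] [LieAlgebra K g]
  {L : Type*} [LieRing L] [LieAlgebra K L] [FiniteDimensional K L] [LieAlgebra.IsKilling K L]

variable (K L) in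
theorem ad_injective : Function.Injective (LieAlgebra.ad K L) := by
  refine (injective_iff_map_eq_zero _).2 fun x hx => ?_
  have hx' : x ∈ LieAlgebra.center K L :=
    (LieModule.mem_maxTrivSubmodule K L L x).2 fun y => by
      rw [← lie_skew, ← LieAlgebra.ad_apply K, hx, LinearMap.zero_apply, neg_zero]
  rwa [LieAlgebra.center_eq_bot, LieSubmodule.mem_bot] at hx'

/-- An element of a semisimple Lie algebra orthogonal to all brackets vanishes. -/
theorem eq_zero_of_killingForm_lie {a : L} (h : ∀ x y : L, killingForm K L a ⁅x, y⁆ = 0) :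
    a = 0 := by
  have hker : ∀ z, z ∈ LinearMap.ker (killingForm K L) → z = 0 := by
    intro z hz
    rwa [LieAlgebra.IsKilling.ker_killingForm_eq_bot] at hz
  have hlie : ∀ x : L, ⁅a, x⁆ = 0 := fun x => hker _ <| LinearMap.ext fun y => by
    rw [LieModule.traceForm_apply_lie_apply, h, LinearMap.zero_apply]
  exact (injective_iff_map_eq_zero _).1 (ad_injective K L) a (LinearMap.ext hlie)

/-- For a surjection `p` of `g` with central kernel onto a semisimple Lie algebra and a functional
`ψ` on `g`, the form `ψ [x, y]` is `κ(a, [p x, p y])` for some `a`, where `κ` is the Killing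
form. -/
theorem exists_killingForm_eq (p : g →ₗ⁅K⁆ L) (hp : Function.Surjective p)
    (hc : ∀ x, p x = 0 → ∀ y : g, ⁅x, y⁆ = 0) (ψ : g →ₗ[K] K) :
    ∃ a : L, ∀ x y, ψ ⁅x, y⁆ = killingForm K L a ⁅p x, p y⁆ := by
  obtain ⟨s, hs⟩ := (p : g →ₗ[K] L).exists_rightInverse_of_surjective
    (LinearMap.range_eq_top.2 hp)
  have hps : ∀ x, p (s x) = x := LinearMap.congr_fun hs
  have hlie : ∀ x y, ⁅s (p x), s (p y)⁆ = ⁅x, y⁆ := by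
    intro x y
    have h1 := hc (s (p x) - x) (by rw [map_sub, hps, sub_self])
    have h2 := hc (s (p y) - y) (by rw [map_sub, hps, sub_self])
    have h3 := h1 (s (p y))
    have h4 := h2 x
    rw [sub_lie, sub_eq_zero] at h3 h4
    rw [h3, ← lie_skew, h4, lie_skew]
  -- Since the kernel of `p` is central, `ψ ⁅x, y⁆` descends to a form `ω` on `L`. By the Jacobi
  -- identity the map `D₀` with `κ(D₀ x, y) = ω(x, y)` is a derivation, and every derivation of `L`
  -- is inner.
  let ω : L →ₗ[K] L →ₗ[K] K := LinearMap.mk₂ K (fun x y => ψ ⁅s x, s y⁆)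
    (by simp) (by simp) (by simp) (by simp)
  have hω : ∀ x y, ω (p x) (p y) = ψ ⁅x, y⁆ := fun x y => congrArg ψ (hlie x y)
  have hnd : (killingForm K L).Nondegenerate := LieAlgebra.IsKilling.killingForm_nondegenerate K L
  let e := LinearMap.BilinForm.toDual (killingForm K L) hnd
  let D₀ : L →ₗ[K] L := e.symm.toLinearMap ∘ₗ ω
  have hD₀ : ∀ x y, killingForm K L (D₀ x) y = ω x y := fun x y =>
    LinearMap.BilinForm.apply_toDual_symm_apply (hB := hnd) (ω x) y
  have hinj : ∀ a b : L, (∀ z, killingForm K L a z = killingForm K L b z) → a = b := by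
    intro a b h
    rw [← sub_eq_zero]
    have : a - b ∈ LinearMap.ker (killingForm K L) := LinearMap.ext fun z => by simp [h]
    rwa [LieAlgebra.IsKilling.ker_killingForm_eq_bot] at this
  let D : LieDerivation K L L := LieDerivation.mk D₀ fun x y => by
    refine hinj _ _ fun z => ?_
    obtain ⟨x, rfl⟩ := hp x
    obtain ⟨y, rfl⟩ := hp y
    obtain ⟨z, rfl⟩ := hp z
    rw [map_sub, LinearMap.sub_apply, ← lie_skew (p x) (D₀ _), ← lie_skew (p y) (D₀ _),
      map_neg, map_neg,
      LinearMap.neg_apply, LinearMap.neg_apply, LieModule.traceForm_apply_lie_apply,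
      LieModule.traceForm_apply_lie_apply, hD₀, hD₀, hD₀, ← LieHom.map_lie, ← LieHom.map_lie,
      ← LieHom.map_lie, hω, hω, hω, lie_lie, map_sub]
    ring
  obtain ⟨a, ha⟩ := LieDerivation.IsKilling.exists_eq_ad D
  refine ⟨a, fun x y => ?_⟩
  rw [← hω, ← hD₀, ← LieModule.traceForm_apply_lie_apply]
  congr 2
  have h := DFunLike.congr_fun ha (p x)
  rw [LieDerivation.ad_apply_apply] at h
  exact h.symm

end Cocycle

/-! ### The semisimple quotient by the center -/

section Reductive

variable {K : Type*} [Field K] {g : Type*} [LieRing g] [LieAlgebra K g]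
  [FiniteDimensional K g]

/-- The quotient of a reductive Lie algebra by its center is semisimple. -/
theorem isKilling_quotient_center [CharZero K] [LieAlgebra.HasCentralRadical K g] :
    LieAlgebra.IsKilling K (g ⧸ LieAlgebra.center K g) := by
  have : LieAlgebra.HasTrivialRadical K (g ⧸ LieAlgebra.center K g) := by
    refine LieAlgebra.hasTrivialRadical_of_no_solvable_ideals fun I hI => ?_
    let q := quotientHom (LieAlgebra.center K g)
    -- The preimage of a solvable ideal is an extension with central kernel, hence solvable, hence
    -- contained in the radical, which is the center.
    let J : LieIdeal K g := I.comap q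
    have hJ : ∀ x : J, q x ∈ I := fun x => LieIdeal.mem_comap.1 x.2
    let f : J →ₗ⁅K⁆ I :=
      { toFun := fun x => ⟨q x, hJ x⟩
        map_add' := fun x y => Subtype.ext (map_add q _ _)
        map_smul' := fun c x => Subtype.ext (map_smul q _ _)
        map_lie' := Subtype.ext (LieHom.map_lie q _ _) }
    have hab : IsLieAbelian f.ker := ⟨fun x y => by
      have hx : q ((x : J) : g) = 0 := congrArg Subtype.val (LieHom.mem_ker.1 x.2)
      have hx' := quotientHom_eq_zero.1 hx
      refine Subtype.ext (Subtype.ext ?_)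
      change ⁅((x : J) : g), ((y : J) : g)⁆ = 0
      rw [← lie_skew, (LieModule.mem_maxTrivSubmodule K g g _).1 hx', neg_zero]⟩
    have hsolv : LieAlgebra.IsSolvable J := isSolvable_of_ker f
    have hle := (LieAlgebra.LieIdeal.solvable_iff_le_radical K g J).1 hsolv
    rw [LieAlgebra.radical_eq_center] at hle
    rw [LieSubmodule.eq_bot_iff]
    intro z hz
    obtain ⟨x, rfl⟩ := quotientHom_surjective _ z
    exact quotientHom_eq_zero.2 (hle (LieIdeal.mem_comap.2 hz))
  infer_instance

theorem map_center_eq (θ : g ≃ₗ⁅K⁆ g) :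
    (LieAlgebra.center K g).toSubmodule.map (θ.toLinearEquiv : g →ₗ[K] g) =
      (LieAlgebra.center K g).toSubmodule := by
  refine Submodule.eq_of_le_of_finrank_le ?_ (LinearEquiv.finrank_map_eq θ.toLinearEquiv _).ge
  rintro _ ⟨z, hz, rfl⟩
  refine (LieModule.mem_maxTrivSubmodule K g g _).2 fun x => ?_
  have h : ⁅θ.symm x, z⁆ = 0 := (LieModule.mem_maxTrivSubmodule K g g z).1 hz _
  have h' := congrArg θ h
  rw [LieEquiv.map_lie, LieEquiv.apply_symm_apply, map_zero] at h'
  exact h'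

/-- The automorphism induced on the quotient by the center. -/
noncomputable def centerQuotientEquiv (θ : g ≃ₗ⁅K⁆ g) :
    (g ⧸ LieAlgebra.center K g) ≃ₗ⁅K⁆ (g ⧸ LieAlgebra.center K g) :=
  { Submodule.Quotient.equiv _ _ θ.toLinearEquiv (map_center_eq θ) with
    map_lie' := by
      intro x y
      obtain ⟨x, rfl⟩ := quotientHom_surjective _ x
      obtain ⟨y, rfl⟩ := quotientHom_surjective _ y
      change quotientHom (LieAlgebra.center K g) (θ ⁅x, y⁆) = ⁅quotientHom _ (θ x), quotientHom _ (θ y)⁆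
      rw [LieEquiv.map_lie, LieHom.map_lie] }

theorem centerQuotientEquiv_apply (θ : g ≃ₗ⁅K⁆ g) (x : g) :
    centerQuotientEquiv θ (quotientHom (LieAlgebra.center K g) x) =
      quotientHom (LieAlgebra.center K g) (θ x) := rfl

end Reductive

/-! ### Homogeneous elements of the twisted loop algebra -/

section Homogeneous

variable {K : Type*} [Field K] {g : Type*} [LieRing g] [LieAlgebra K g]

variable (K) in
/-- The linear map `ξ ↦ ξ t ^ k`. -/
noncomputable def monoLin (k : ℤ) : g →ₗ[K] Loop K g :=
  (coeffEquiv (K := K) (g := g)).symm.toLinearMap ∘ₗ Finsupp.lsingle k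

theorem monoLin_apply (k : ℤ) (ξ : g) : monoLin K k ξ = mono (K := K) k ξ :=
  (LinearEquiv.symm_apply_eq _).2 (coeffEquiv_mono k ξ).symm

theorem coeff_monoLin (k l : ℤ) (ξ : g) : coeff l (monoLin K k ξ) = if k = l then ξ else 0 := by
  rw [monoLin_apply, coeff_mono]

theorem lie_monoLin (k l : ℤ) (ξ η : g) :
    ⁅monoLin K k ξ, monoLin K l η⁆ = monoLin K (k + l) ⁅ξ, η⁆ := by
  rw [monoLin_apply, monoLin_apply, monoLin_apply, lie_mono]

theorem projNonneg_monoLin (k : ℤ) (ξ : g) :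
    projNonneg K g (monoLin K k ξ) = if 0 ≤ k then monoLin K k ξ else 0 := by
  apply ext_coeff
  intro l
  rw [coeff_projNonneg]
  by_cases hk : 0 ≤ k <;> by_cases hl : 0 ≤ l <;> simp only [hk, hl, if_true, if_false, map_zero]
  · rw [coeff_monoLin, if_neg (by omega)]
  · rw [coeff_monoLin, if_neg (by omega)]

theorem monoLin_mem_twistedLoop {θ : g ≃ₗ⁅K⁆ g} {ζ : Kˣ} {k : ℤ} {ξ : g}
    (h : θ ξ = ((ζ ^ (-k) : Kˣ) : K) • ξ) : monoLin K k ξ ∈ twistedLoop θ ζ := by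
  rw [mem_twistedLoop_iff]
  intro l
  rw [coeff_monoLin]
  split_ifs with hl
  · rw [← hl, h]
  · simp

theorem monoLin_mem_supported {S : Set ℤ} {k : ℤ} (hk : k ∈ S) (ξ : g) :
    monoLin K k ξ ∈ supported K g S := by
  intro l hl
  rw [coeff_monoLin, if_neg]
  rintro rfl
  exact hl hk

theorem map_coeff_eq {θ : g ≃ₗ⁅K⁆ g} {ζ : Kˣ} (v : twistedNonneg θ ζ) (k : ℤ) :
    θ (coeff k (v : Loop K g)) = ((ζ ^ (-k) : Kˣ) : K) • coeff k (v : Loop K g) :=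
  (mem_twistedLoop_iff θ ζ _).1 v.2.1 k

theorem coeff_eq_zero_of_neg {θ : g ≃ₗ⁅K⁆ g} {ζ : Kˣ} (v : twistedNonneg θ ζ) {k : ℤ}
    (hk : k < 0) : coeff k (v : Loop K g) = 0 :=
  v.2.2 k (by simpa using hk)

theorem exists_coeff_eq_zero (x : Loop K g) : ∃ N : ℕ, ∀ k : ℤ, (N : ℤ) < k → coeff k x = 0 := by
  obtain ⟨B, hB⟩ := (coeffEquiv x).support.bddAbove
  refine ⟨B.toNat, fun k hk => ?_⟩
  by_contra hne
  have : k ≤ B := hB (Finsupp.mem_support_iff.2 hne)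
  omega

/-- The order of an automorphism bounds its powers. -/
theorem toLinearMap_pow_eq_one {θ : g ≃ₗ⁅K⁆ g} {m : ℕ} (hθ : orderOf θ.toLinearEquiv = m) :
    (θ.toLinearEquiv : g →ₗ[K] g) ^ m = 1 := by
  have h : θ.toLinearEquiv ^ m = 1 := hθ ▸ pow_orderOf_eq_one _
  have h' : ∀ (e : g ≃ₗ[K] g) (n : ℕ), ((e ^ n : g ≃ₗ[K] g) : g →ₗ[K] g) = (e : g →ₗ[K] g) ^ n :=
    fun e n => map_pow (LinearEquiv.automorphismGroup.toLinearMapMonoidHom (R := K) (M := g)) e n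
  rw [← h', h]
  rfl

variable {θ : g ≃ₗ⁅K⁆ g} {ζ : Kˣ} {m : ℕ}

/-- The data of an automorphism of finite order and of a root of unity. -/
structure IsTwist (θ : g ≃ₗ⁅K⁆ g) (ζ : Kˣ) (m : ℕ) : Prop where
  pos : 0 < m
  root : IsPrimitiveRoot (ζ : K) m
  pow_eq_one : (θ.toLinearEquiv : g →ₗ[K] g) ^ m = 1

theorem IsTwist.zeta_pow (h : IsTwist θ ζ m) : ζ ^ m = 1 :=
  Units.ext (by simpa using h.root.pow_eq_one)

theorem monoLin_mem_twistedNonneg (h : IsTwist θ ζ m) (k : ℕ) (ξ : g) :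
    monoLin K k (eigenProj m ζ (θ.toLinearEquiv : g →ₗ[K] g) (-k) ξ) ∈ twistedNonneg θ ζ :=
  ⟨monoLin_mem_twistedLoop (map_eigenProj_apply h.zeta_pow h.pow_eq_one _ ξ),
    monoLin_mem_supported (Set.mem_Ici.2 (Int.natCast_nonneg k)) _⟩

theorem monoLin_mem_twistedNonpos (h : IsTwist θ ζ m) (k : ℕ) (ξ : g) :
    monoLin K (-k) (eigenProj m ζ (θ.toLinearEquiv : g →ₗ[K] g) k ξ) ∈ twistedNonpos θ ζ :=
  ⟨monoLin_mem_twistedLoop (by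
      rw [neg_neg]; exact map_eigenProj_apply h.zeta_pow h.pow_eq_one _ ξ),
    monoLin_mem_supported (Set.mem_Iic.2 (by simp)) _⟩

/-- The linear map sending `ξ` to the component of `ξ t ^ k` in `g[t]^Θ`, for `k ≥ 0`. -/
noncomputable def homNonneg (h : IsTwist θ ζ m) (k : ℕ) : g →ₗ[K] twistedNonneg θ ζ where
  toFun ξ := ⟨_, monoLin_mem_twistedNonneg h k ξ⟩
  map_add' ξ η := Subtype.ext (by simp)
  map_smul' c ξ := Subtype.ext (by simp)

/-- The linear map sending `ξ` to the component of `ξ t ^ (-k)` in `g[t⁻¹]^Θ`, for `k ≥ 0`. -/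
noncomputable def homNonpos (h : IsTwist θ ζ m) (k : ℕ) : g →ₗ[K] twistedNonpos θ ζ where
  toFun ξ := ⟨_, monoLin_mem_twistedNonpos h k ξ⟩
  map_add' ξ η := Subtype.ext (by simp)
  map_smul' c ξ := Subtype.ext (by simp)

theorem coe_homNonneg (h : IsTwist θ ζ m) (k : ℕ) (ξ : g) :
    (homNonneg h k ξ : Loop K g) =
      monoLin K k (eigenProj m ζ (θ.toLinearEquiv : g →ₗ[K] g) (-k) ξ) := rfl

theorem coe_homNonpos (h : IsTwist θ ζ m) (k : ℕ) (ξ : g) :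
    (homNonpos h k ξ : Loop K g) =
      monoLin K (-k) (eigenProj m ζ (θ.toLinearEquiv : g →ₗ[K] g) k ξ) := rfl

/-- Bracketing with an eigenvector shifts eigenvalues. Thus the test elements `η` below may be
arbitrary, with the projection absorbed into `homNonneg`. -/
theorem eigenProj_lie {b : ℤ} {ξ : g} (hξ : θ ξ = ((ζ ^ b : Kˣ) : K) • ξ) (a : ℤ) (η : g) :
    eigenProj m ζ (θ.toLinearEquiv : g →ₗ[K] g) (a + b) ⁅η, ξ⁆ =
      ⁅eigenProj m ζ (θ.toLinearEquiv : g →ₗ[K] g) a η, ξ⁆ := by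
  rw [eigenProj_apply, eigenProj_apply, smul_lie, sum_lie]
  congr 1
  refine Finset.sum_congr rfl fun j _ => ?_
  have hξ' : (θ.toLinearEquiv : g →ₗ[K] g) ξ = ((ζ ^ b : Kˣ) : K) • ξ := hξ
  rw [lieEquiv_pow_apply_lie, pow_apply_of_eigen hξ', lie_smul, smul_smul, smul_lie,
    ← Units.val_mul, ← zpow_natCast, ← zpow_mul, ← zpow_add]
  congr 3
  ring_nf

variable [CharZero K]

theorem coe_homNonneg_coeff (h : IsTwist θ ζ m) (v : twistedNonneg θ ζ) (k : ℕ) :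
    (homNonneg h k (coeff k (v : Loop K g)) : Loop K g) =
      monoLin K k (coeff k (v : Loop K g)) := by
  have hk : (θ.toLinearEquiv : g →ₗ[K] g) (coeff k (v : Loop K g)) = _ := map_coeff_eq v k
  rw [coe_homNonneg, eigenProj_apply_of_eigen h.pos hk]

theorem eq_sum_homNonneg (h : IsTwist θ ζ m) (v : twistedNonneg θ ζ) {N : ℕ}
    (hN : ∀ k : ℤ, (N : ℤ) < k → coeff k (v : Loop K g) = 0) :
    v = ∑ k ∈ Finset.range (N + 1), homNonneg h k (coeff k (v : Loop K g)) := by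
  apply Subtype.ext
  apply ext_coeff
  intro l
  rw [AddSubmonoidClass.coe_finsetSum, map_sum]
  simp only [coe_homNonneg_coeff, coeff_monoLin]
  rcases lt_or_ge l 0 with hl | hl
  · rw [coeff_eq_zero_of_neg v hl, Finset.sum_eq_zero]
    intro k _
    rw [if_neg (by omega)]
  · lift l to ℕ using hl
    simp only [Nat.cast_inj, Finset.sum_ite_eq', Finset.mem_range]
    split_ifs with hlN
    · rfl
    · exact hN _ (by omega)

theorem lie_homNonneg (h : IsTwist θ ζ m) (v w : twistedNonneg θ ζ) (k l : ℕ) :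
    ⁅homNonneg h k (coeff k (v : Loop K g)), homNonneg h l (coeff l (w : Loop K g))⁆ =
      homNonneg h (k + l) ⁅coeff k (v : Loop K g), coeff l (w : Loop K g)⁆ := by
  apply Subtype.ext
  rw [LieSubalgebra.coe_bracket, coe_homNonneg_coeff, coe_homNonneg_coeff, lie_monoLin,
    coe_homNonneg, eigenProj_apply_of_eigen h.pos, Nat.cast_add]
  rw [Nat.cast_add, neg_add, zpow_add]
  change θ _ = _
  rw [LieEquiv.map_lie, map_coeff_eq, map_coeff_eq, smul_lie, lie_smul, smul_smul, Units.val_mul]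

theorem action_homNonpos (h : IsTwist θ ζ m) (v : twistedNonneg θ ζ) (j k : ℕ) (η : g) :
    action θ ζ (homNonpos h j η) (homNonneg h (j + k) (coeff (j + k : ℕ) (v : Loop K g))) =
      homNonneg h k ⁅η, coeff (j + k : ℕ) (v : Loop K g)⁆ := by
  apply Subtype.ext
  rw [coe_action, coe_homNonneg_coeff, coe_homNonpos, lie_monoLin, projNonneg_monoLin,
    if_pos (by push_cast; omega), coe_homNonneg, ← eigenProj_lie (map_coeff_eq v _)]
  rw [show (-(j : ℤ) + (j + k : ℕ)) = k by push_cast; ring,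
    show ((j : ℤ) + -(j + k : ℕ)) = -k by push_cast; ring]

theorem action_homNonpos_eq_zero (h : IsTwist θ ζ m) (v : twistedNonneg θ ζ) {j k : ℕ}
    (hk : k < j) (η : g) :
    action θ ζ (homNonpos h j η) (homNonneg h k (coeff k (v : Loop K g))) = 0 := by
  apply Subtype.ext
  rw [coe_action, coe_homNonneg_coeff, coe_homNonpos, lie_monoLin, projNonneg_monoLin,
    if_neg (by omega)]
  rfl

theorem apply_lie_eq_sum (h : IsTwist θ ζ m) (A : twistedNonneg θ ζ →ₗ[K] K)
    (v w : twistedNonneg θ ζ) {N : ℕ}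
    (hv : ∀ k : ℤ, (N : ℤ) < k → coeff k (v : Loop K g) = 0)
    (hw : ∀ k : ℤ, (N : ℤ) < k → coeff k (w : Loop K g) = 0) :
    A ⁅v, w⁆ = ∑ k ∈ Finset.range (N + 1), ∑ l ∈ Finset.range (N + 1),
      A (homNonneg h (k + l) ⁅coeff k (v : Loop K g), coeff l (w : Loop K g)⁆) := by
  conv_lhs => rw [eq_sum_homNonneg h v hv, eq_sum_homNonneg h w hw]
  rw [Finset.sum_comm]
  simp only [sum_lie, lie_sum, map_sum, lie_homNonneg]

/-- Coefficients of `v` of degree below `j` are pushed to negative degrees, where the projection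
kills them. -/
theorem apply_action_eq_sum (h : IsTwist θ ζ m) (A : twistedNonneg θ ζ →ₗ[K] K)
    (v : twistedNonneg θ ζ) {j n : ℕ}
    (hv : ∀ k : ℤ, ((j + n : ℕ) : ℤ) < k → coeff k (v : Loop K g) = 0) (η : g) :
    A (action θ ζ (homNonpos h j η) v) = ∑ k ∈ Finset.range (n + 1),
      A (homNonneg h k ⁅η, coeff (j + k : ℕ) (v : Loop K g)⁆) := by
  conv_lhs => rw [eq_sum_homNonneg h v hv]
  rw [map_sum, map_sum, add_assoc, Finset.sum_range_add, Finset.sum_eq_zero, zero_add]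
  · simp only [action_homNonpos]
  · intro k hk
    rw [action_homNonpos_eq_zero h v (Finset.mem_range.1 hk), map_zero]

end Homogeneous

/-! ### Functionals on the twisted loop algebra -/

section Functional

open Finset

/-- The substitution `i = N - k`, `j = N - l` turns `s + i + j = 2 N` into `s = k + l`. It matches a
coefficient of a triple product of series with reversed polynomials against a pairing of the
original ones. -/
theorem sum_antidiagonal_antidiagonal {M : Type*} [AddCommMonoid M] {N : ℕ} {F : ℕ → ℕ → ℕ → M}
    (h₁ : ∀ s i j, N < i → F s i j = 0) (h₂ : ∀ s i j, N < j → F s i j = 0) :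
    ∑ p ∈ antidiagonal (2 * N), ∑ p' ∈ antidiagonal p.1, F p'.1 p'.2 p.2 =
      ∑ k ∈ range (N + 1), ∑ l ∈ range (N + 1), F (k + l) (N - k) (N - l) := by
  have inner : ∀ r j, N ≤ r → ∑ p' ∈ antidiagonal r, F p'.1 p'.2 j =
      ∑ k ∈ range (N + 1), F (r - (N - k)) (N - k) j := by
    intro r j hr
    rw [← Nat.sum_antidiagonal_swap, Nat.sum_antidiagonal_eq_sum_range_succ_mk,
      ← sum_range_reflect (fun i => F (r - (N - i)) (N - i) j)]
    symm
    refine (sum_congr rfl fun i hi => ?_).trans (sum_subset (s₁ := range (N + 1)) ?_ ?_)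
    · have hi' : N - (N + 1 - 1 - i) = i := by have := mem_range.1 hi; omega
      rw [hi']
      rfl
    · exact range_subset_range.2 (by omega)
    · intro i _ hi
      exact h₁ _ _ _ (by rw [mem_range] at hi; simp only [Prod.snd_swap]; omega)
  rw [← Nat.sum_antidiagonal_swap, Nat.sum_antidiagonal_eq_sum_range_succ_mk, sum_comm,
    ← sum_range_reflect (fun l => ∑ k ∈ range (N + 1), F (k + l) (N - k) (N - l))]
  symm
  refine (sum_congr rfl fun j hj => ?_).trans (sum_subset (s₁ := range (N + 1)) ?_ ?_)
  · have hj' := mem_range.1 hj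
    change _ = ∑ p' ∈ antidiagonal (2 * N - j), F p'.1 p'.2 j
    rw [inner _ _ (by omega)]
    refine sum_congr rfl fun k hk => ?_
    have hk' := mem_range.1 hk
    congr 1 <;> [congr 1; skip] <;> omega
  · exact range_subset_range.2 (by omega)
  · intro j _ hj
    exact sum_eq_zero fun p _ => h₂ _ _ _ (by rw [mem_range] at hj; simp only [Prod.snd_swap]; omega)

variable {K : Type*} [Field K] {g : Type*} [LieRing g] [LieAlgebra K g]
  {L : Type*} [LieRing L] [LieAlgebra K L]
  {θ : g ≃ₗ⁅K⁆ g} {ζ : Kˣ} {m : ℕ} {h : IsTwist θ ζ m} {q : g →ₗ⁅K⁆ L}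
  {A : twistedNonneg θ ζ →ₗ[K] K} {a : ℕ → L} {v w : twistedNonneg θ ζ}
  {θ' : L ≃ₗ⁅K⁆ L}

section Perturbation

variable [CharZero K]

/-- Perturbing a functional in degree zero. -/
theorem exists_apply_homNonneg_eq (hθ' : ∀ x, θ' (q x) = q (θ x)) (h : IsTwist θ ζ m) {z : L}
    (hz : θ' z = z) : ∃ B : twistedNonneg θ ζ →ₗ[K] K,
      ∀ k ξ, B (homNonneg h k ξ) = if k = 0 then killingForm K L z (q ξ) else 0 := by
  refine ⟨killingForm K L z ∘ₗ (q : g →ₗ[K] L) ∘ₗ coeff 0 ∘ₗ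
    (twistedNonneg θ ζ).toSubmodule.subtype, fun k ξ => ?_⟩
  change killingForm K L z (q (coeff 0 (homNonneg h k ξ : Loop K g))) = _
  rw [coe_homNonneg, coeff_monoLin]
  by_cases hk : k = 0
  · subst hk
    have hT : ∀ η, killingForm K L z (q (θ η)) = killingForm K L z (q η) := by
      intro η
      conv_lhs => rw [← hθ', ← hz]
      exact LieAlgebra.killingForm_of_equiv_apply θ' _ _
    have hpow : ∀ j : ℕ, killingForm K L z (q (((θ.toLinearEquiv : g →ₗ[K] g) ^ j) ξ)) =
        killingForm K L z (q ξ) := by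
      intro j
      induction j with
      | zero => rfl
      | succ j ih =>
        rw [pow_succ', Module.End.mul_apply]
        exact (hT _).trans ih
    have hm : (m : K) ≠ 0 := Nat.cast_ne_zero.2 h.pos.ne'
    simp only [Nat.cast_zero, neg_zero, if_true, eigenProj_apply, zero_mul, zpow_zero,
      Units.val_one, one_smul, map_smul, map_sum, hpow, sum_const, card_range]
    rw [← Nat.cast_smul_eq_nsmul K, smul_smul, inv_mul_cancel₀ hm, one_smul]
  · rw [if_neg (by exact_mod_cast hk), if_neg hk, map_zero, map_zero]

end Perturbation

variable [LieAlgebra.IsKilling K L]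

/-- The component of degree zero of a functional is fixed by the automorphism. -/
theorem map_eq_self [FiniteDimensional K L] (hq : Function.Surjective q)
    (hθ' : ∀ x, θ' (q x) = q (θ x))
    (hA : ∀ k ξ η, A (homNonneg h k ⁅ξ, η⁆) = killingForm K L (a k) ⁅q ξ, q η⁆) :
    θ' (a 0) = a 0 := by
  have hfix : ∀ ξ, homNonneg h 0 (θ ξ) = homNonneg h 0 ξ := by
    intro ξ
    apply Subtype.ext
    have hξ := eigenProj_apply_map h.zeta_pow h.pow_eq_one 0 ξ
    rw [zpow_zero, Units.val_one, one_smul] at hξ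
    rw [coe_homNonneg, coe_homNonneg]
    exact congrArg (monoLin K ((0 : ℕ) : ℤ)) hξ
  refine sub_eq_zero.1 (eq_zero_of_killingForm_lie (K := K) fun x y => ?_)
  obtain ⟨ξ, hξ⟩ := hq (θ'.symm x)
  obtain ⟨η, hη⟩ := hq (θ'.symm y)
  have hx : x = θ' (q ξ) := by rw [hξ, LieEquiv.apply_symm_apply]
  have hy : y = θ' (q η) := by rw [hη, LieEquiv.apply_symm_apply]
  have hlie : killingForm K L (θ' (a 0)) ⁅x, y⁆ = killingForm K L (a 0) ⁅q ξ, q η⁆ := by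
    rw [hx, hy, ← LieEquiv.map_lie]
    exact LieAlgebra.killingForm_of_equiv_apply θ' _ _
  rw [map_sub, LinearMap.sub_apply, hlie, ← hA, hx, hy, hθ', hθ', ← hA, ← LieEquiv.map_lie, hfix,
    sub_self]

variable [CharZero K]

/-- Invariance tested on elements of degree `-(N - n)`: moving `η` to the other side of the Killing
form isolates the coefficient of order `n` of the commutator of `a` with the reversal of `v`. -/
theorem sum_lie_coeff_eq_zero (hq : Function.Surjective q)
    (hA : ∀ k ξ η, A (homNonneg h k ⁅ξ, η⁆) = killingForm K L (a k) ⁅q ξ, q η⁆)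
    (hv : ∀ y, A (action θ ζ y v) = 0) {N : ℕ}
    (hN : ∀ k : ℤ, (N : ℤ) < k → coeff k (v : Loop K g) = 0) {n : ℕ} (hn : n < N + 1) :
    ∑ p ∈ antidiagonal n, ⁅a p.1, q (coeff ((N : ℤ) - p.2) (v : Loop K g))⁆ = 0 := by
  suffices hz : ∀ y, killingForm K L
      (∑ p ∈ antidiagonal n, ⁅a p.1, q (coeff ((N : ℤ) - p.2) (v : Loop K g))⁆) y = 0 by
    have hker := LinearMap.mem_ker.2 (LinearMap.ext hz)
    rwa [LieAlgebra.IsKilling.ker_killingForm_eq_bot] at hker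
  intro y
  obtain ⟨η, rfl⟩ := hq y
  obtain ⟨j, rfl⟩ : ∃ j, N = j + n := ⟨N - n, by omega⟩
  have hact := hv (homNonpos h j η)
  rw [apply_action_eq_sum h A v hN] at hact
  rw [map_sum, LinearMap.sum_apply, Nat.sum_antidiagonal_eq_sum_range_succ_mk, ← neg_eq_zero,
    ← sum_neg_distrib, ← hact]
  refine sum_congr rfl fun k hk => ?_
  have hk' : ((j + n : ℕ) : ℤ) - (n - k : ℕ) = (j + k : ℕ) := by have := mem_range.1 hk; omega
  rw [hA, LieModule.traceForm_apply_lie_apply, hk', ← map_neg, lie_skew]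

variable [FiniteDimensional K L]

/-- At a functional whose component of degree zero is regular semisimple, the differentials of
invariants commute. -/
theorem apply_lie_eq_zero (hq : Function.Surjective q)
    (hA : ∀ k ξ η, A (homNonneg h k ⁅ξ, η⁆) = killingForm K L (a k) ⁅q ξ, q η⁆)
    (ha : IsRegularSemisimple K (a 0))
    (hv : ∀ y, A (action θ ζ y v) = 0) (hw : ∀ y, A (action θ ζ y w) = 0) : A ⁅v, w⁆ = 0 := by
  obtain ⟨N₁, hN₁⟩ := exists_coeff_eq_zero (v : Loop K g)
  obtain ⟨N₂, hN₂⟩ := exists_coeff_eq_zero (w : Loop K g)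
  obtain ⟨N, hvN, hwN⟩ : ∃ N : ℕ, (∀ k : ℤ, (N : ℤ) < k → coeff k (v : Loop K g) = 0) ∧
      ∀ k : ℤ, (N : ℤ) < k → coeff k (w : Loop K g) = 0 :=
    ⟨max N₁ N₂, fun k hk => hN₁ k (by omega), fun k hk => hN₂ k (by omega)⟩
  -- Reversed polynomials. For `i > N` the index is negative and the coefficient is zero.
  let b : ℕ → L := fun i => q (coeff ((N : ℤ) - i) (v : Loop K g))
  let b' : ℕ → L := fun i => q (coeff ((N : ℤ) - i) (w : Loop K g))
  obtain ⟨c, hc, hcb⟩ := ha.exists_commute_of_forall_le (ad_injective K L) (N + 1) b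
    fun n hn => sum_lie_coeff_eq_zero hq hA hv hvN hn
  have htr := trace_coeff_commutator_mul_eq_zero (N := N) (α := adSeries K a) (β := adSeries K b)
    (γ := adSeries K b') (c := c)
    (fun n hn => by
      rw [coeff_commutator_adSeries, sum_lie_coeff_eq_zero hq hA hw hwN hn, map_zero]) hc
    (fun n hn => by rw [hcb n hn, coeff_adSeries])
  have hsum : ∑ p ∈ antidiagonal (2 * N), ∑ p' ∈ antidiagonal p.1,
      killingForm K L ⁅a p'.1, b p'.2⁆ (b' p.2) = 0 := by
    rw [← htr, PowerSeries.coeff_mul, map_sum]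
    refine sum_congr rfl fun p _ => ?_
    rw [coeff_commutator_adSeries, coeff_adSeries, ← LinearMap.sum_apply,
      ← map_sum]
    rfl
  rw [sum_antidiagonal_antidiagonal (N := N)
    (F := fun s i j => killingForm K L ⁅a s, b i⁆ (b' j))] at hsum
  · rw [apply_lie_eq_sum h A v w hvN hwN, ← hsum]
    refine sum_congr rfl fun k hk => sum_congr rfl fun l hl => ?_
    have hk' : (N : ℤ) - (N - k : ℕ) = k := by have := mem_range.1 hk; omega
    have hl' : (N : ℤ) - (N - l : ℕ) = l := by have := mem_range.1 hl; omega
    simp only [b, b', hk', hl', hA, LieModule.traceForm_apply_lie_apply]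
  · intro s i j hi
    simp only [b]
    rw [coeff_eq_zero_of_neg v (by omega), map_zero, lie_zero, map_zero, LinearMap.zero_apply]
  · intro s i j hj
    simp only [b']
    rw [coeff_eq_zero_of_neg w (by omega), map_zero, map_zero]

variable [IsAlgClosed K]

theorem poisson_eq_zero (hq : Function.Surjective q) (hc : ∀ x, q x = 0 → ∀ y : g, ⁅x, y⁆ = 0)
    (hθ' : ∀ x, θ' (q x) = q (θ x)) (h : IsTwist θ ζ m)
    {F G : SymmetricAlgebra K (twistedNonneg θ ζ)} (hF : F ∈ invariants θ ζ)
    (hG : G ∈ invariants θ ζ) : poisson F G = 0 := by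
  have hpow : (θ'.toLinearEquiv : L →ₗ[K] L) ^ m = 1 := by
    have hj : ∀ (j : ℕ) x, ((θ'.toLinearEquiv : L →ₗ[K] L) ^ j) (q x) =
        q (((θ.toLinearEquiv : g →ₗ[K] g) ^ j) x) := by
      intro j x
      induction j with
      | zero => rfl
      | succ j ih =>
        rw [pow_succ', pow_succ', Module.End.mul_apply, Module.End.mul_apply, ih]
        exact hθ' _
    refine LinearMap.ext fun y => ?_
    obtain ⟨x, rfl⟩ := hq y
    rw [hj, h.pow_eq_one]
    rfl
  refine eq_zero_of_evalAt_line fun A => ?_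
  choose a ha using fun k : ℕ => exists_killingForm_eq q hq hc (A ∘ₗ homNonneg h k)
  have ha₀ : θ' (a 0) = a 0 := map_eq_self hq hθ' (h := h) (A := A) (a := a) ha
  let y₀ : fixedPoints θ' := ⟨a 0, ha₀⟩
  obtain ⟨x₀, hx₀⟩ := LinearMap.exists_isNilRegular (fixedAd θ')
  -- Moving along `B` changes only the leading term `a 0`, within the fixed points, and reaches the
  -- regular element `x₀` at `c = 1`. So all but finitely many `c` give a regular leading term.
  obtain ⟨B, hB⟩ := exists_apply_homNonneg_eq hθ' h (z := ((x₀ - y₀ : fixedPoints θ') : L))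
    (x₀ - y₀).2
  refine ⟨B, (finite_not_isNilRegular (fixedAd θ') hx₀ y₀).subset fun c hne hreg => hne ?_⟩
  have hss := isRegularSemisimple_of_isNilRegular h.pos h.root hpow hreg
  obtain ⟨v, hv⟩ := exists_gradient (A + c • B) F
  obtain ⟨w, hw⟩ := exists_gradient (A + c • B) G
  -- Evaluating at the functional the derivation that annihilates an invariant gives the
  -- infinitesimal condition on its differential.
  have hinv : ∀ {F' v'}, F' ∈ invariants θ ζ → (∀ f : twistedNonneg θ ζ →ₗ[K] _,
      evalAt (A + c • B) (derivLift f F') = evalAt (A + c • B) (f v')) →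
      ∀ y, (A + c • B) (action θ ζ y v') = 0 := by
    intro F' v' hF' hv' y
    rw [← evalAt_ι]
    refine (hv' (SymmetricAlgebra.ι K _ ∘ₗ action θ ζ y)).symm.trans ?_
    rw [hF' y, map_zero]
  rw [evalAt_poisson _ hv hw]
  refine apply_lie_eq_zero (h := h) (a := fun k => if k = 0 then
    ((y₀ + c • (x₀ - y₀) : fixedPoints θ') : L) else a k) hq (fun k ξ η => ?_) ?_
    (hinv hF hv) (hinv hG hw)
  · have hA : A (homNonneg h k ⁅ξ, η⁆) = _ := ha k ξ η
    rw [LinearMap.add_apply, LinearMap.smul_apply, hA, hB]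
    by_cases hk : k = 0
    · subst hk
      rw [if_pos rfl, if_pos rfl, LieHom.map_lie]
      change _ = killingForm K L (a 0 + c • ((x₀ - y₀ : fixedPoints θ') : L)) _
      rw [map_add, map_smul, LinearMap.add_apply, LinearMap.smul_apply]
    · rw [if_neg hk, if_neg hk, smul_zero, add_zero]
  · simpa using hss

end Functional

end TwistedLoop

theorem mainTheorem4 (K : Type*) [Field K] [IsAlgClosed K] [CharZero K]
    (g : Type*) [LieRing g] [LieAlgebra K g] [FiniteDimensional K g]
    [LieAlgebra.HasCentralRadical K g]
    (θ : g ≃ₗ⁅K⁆ g) (m : ℕ) (hm : 0 < m) (hθ : orderOf θ.toLinearEquiv = m)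
    (ζ : Kˣ) (hζ : IsPrimitiveRoot (ζ : K) m) :
    TwistedLoop.IsPoissonCommutative (TwistedLoop.invariants θ ζ) := by
  intro F hF G hG
  have := TwistedLoop.isKilling_quotient_center (K := K) (g := g)
  refine TwistedLoop.poisson_eq_zero (q := TwistedLoop.quotientHom (LieAlgebra.center K g))
    (θ' := TwistedLoop.centerQuotientEquiv θ) (TwistedLoop.quotientHom_surjective _)
    (fun x hx y => ?_) (TwistedLoop.centerQuotientEquiv_apply θ)
    ⟨hm, hζ, TwistedLoop.toLinearMap_pow_eq_one hθ⟩ hF hG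
  have hx' := (LieModule.mem_maxTrivSubmodule K g g x).1 (TwistedLoop.quotientHom_eq_zero.1 hx) y
  rw [← lie_skew, hx', neg_zero]
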